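/- **Asynchronous model.** Let $\mathcal W\subseteq\mathbb R^n$ be the domain and $f$ a differentiable function on $\mathcal W$, and let $g$ be a stochastic gradient oracle: for every $w\in\mathcal W$, $\mathbb E[g(w)]=\nabla f(w)$ and $\mathbb E\|g(w)-\nabla f(w)\|^2\le\sigma^2$, where $\sigma\ge 0$, and different calls use independent randomness. There are $T>0$ rounds and a delay sequence $d_1,\dots,d_T$ of integers with $0\le d_t<t$, fixed in advance. In round $t$ the algorithm plays a model $w_t\in\mathcal W$ and receives $(g_t,d_t)$, where $g_t$ is a fresh stochastic gradient of $f$ at $w_{t-d_t}$. For $q\in(0,1]$, a $q$-quantile delay is a $\tau_q\ge0$ with $\Pr(d\le\tau_q)\ge q$ and $\Pr(d\ge\tau_q)\ge1-q$, where $d$ is uniform on $d_1,\dots,d_T$; for $q=1$, $\tau_1=\max_t d_t$. Let $q\in(0,1]$ and let $\bar\tau_q\ge\tau_q$ be a real number. **Asynchronous mini-batching (Algorithm 1)** with batch size $B$ and a $K$-query first-order algorithm $\mathcal A$: for $k=1,\dots,K$, take the query $\tilde w_k$ of $\mathcal A$, let $t_k$ be the current round, and play $\tilde w_k$ in rounds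 $t_k,t_k+1,\dots$ until $B$ gradients $g_t$ with $t_k\le t-d_t$ have been received; send their average to $\mathcal A$ as the response. After $K$ responses, return the output of $\mathcal A$. Use $$B=\lceil\max\{1,\bar\tau_q\}\rceil,\qquad K=\Big\lfloor\frac{qT}{1+2\bar\tau_q}\Big\rfloor,\qquad s=\frac{\sigma}{\sqrt{\max\{1,\bar\tau_q\}}} ,$$ and an initial point $w_1\in\mathcal W$, where $\mathcal A$ is one of the following ($v_k$ is the response to the $k$-th query; if $K=0$ the output is $w_1$): - *SGD*: queries $w_1,\dots,w_K$ with $w_{k+1}=w_k-\gamma v_k$; the output is $w_R$, with $R$ uniform on $\{1,\dots,K\}$ and independent of the gradients. - *Accelerated SGD*: $x_0=\bar x_0=w_1$, $\alpha_k=\frac2{k+1}$, query $(1-\alpha_k)\bar x_{k-1}+\alpha_kx_{k-1}$, then $x_k=x_{k-1}-\gamma k\,v_k$ and $\bar x_k=(1-\alpha_k)\bar x_{k-1}+\alpha_kx_k$; the output is $\bar x_K$. - *Projected SGD*: queries $w_1,\dots,w_K$ with $w_{k+1}=\Pi_{\mathcal W}(w_k-\gamma v_k)$, where $\Pi_{\mathcal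 W}$ is the Euclidean projection; the output is $\frac1K\sum_{k=1}^Kw_k$. **Theorem.** There is an absolute constant $C$ such that, for all data as above, in each of the following cases the $K$ queries are answered within the $T$ rounds, and the output $\widehat w$ satisfies the stated bound (a quotient by $s=0$ in a minimum is read as $+\infty$). 1. (Non-convex smooth, SGD.) Let $\mathcal W=\mathbb R^n$, let $f$ be $\beta$-smooth (that is, $\nabla f$ is $\beta$-Lipschitz) with $\beta>0$ and $f\ge f^\star$, and let $F\ge f(w_1)-f^\star$ and $\gamma=\min\{\frac1\beta,\sqrt{\frac{2F}{s^2\beta K}}\}$. Then $$\mathbb E\|\nabla f(\widehat w)\|^2\le C\Big(\frac{(1+\bar\tau_q)\beta F}{qT}+\frac{\sigma\sqrt{\beta F}}{\sqrt{qT}}\Big).$$ 2. (Convex smooth, SGD.) Let $\mathcal W=\mathbb R^n$, let $f$ be convex and $\beta$-smooth with $\beta>0$ and with a minimizer $w^\star$, and let $D\ge\|w_1-w^\star\|$ and $\gamma=\min\{\frac1\beta,\sqrt{\frac{D^2}{s^2K}}\}$. Then $$\mathbb E[f(\widehat w)-f(w^\star)]\le C\Big(\frac{(1+\bar\tau_q)\beta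 D^2}{qT}+\frac{D\sigma}{\sqrt{qT}}\Big).$$ 3. (Convex smooth, accelerated SGD.) For $\mathcal W,f,\beta,w^\star,D$ as in 2 and $\gamma=\min\{\frac1{4\beta},\sqrt{\frac{3D^2}{4s^2K(K+1)^2}}\}$, $$\mathbb E[f(\widehat w)-f(w^\star)]\le C\Big(\frac{(1+\bar\tau_q)^2\beta D^2}{(qT)^2}+\frac{D\sigma}{\sqrt{qT}}\Big).$$ 4. (Convex Lipschitz, projected SGD.) Let $\mathcal W$ be closed and convex with $\|x-y\|\le D$ for all $x,y\in\mathcal W$, where $D>0$, let $f$ be convex and $G$-Lipschitz on $\mathcal W$ with $G\ge0$, and let $\gamma=\frac{D}{\sqrt{(G^2+s^2)K}}$ ($\gamma=0$ if $G=s=0$). Then $f$ attains its minimum on $\mathcal W$, $\widehat w\in\mathcal W$, and $$\mathbb E\big[f(\widehat w)-\min_{w\in\mathcal W}f(w)\big]\le C\,\frac{D(\sqrt{1+\bar\tau_q}\,G+\sigma)}{\sqrt{qT}}.$$ -/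

import Mathlib

open MeasureTheory ProbabilityTheory

noncomputable section

/-! ### Stochastic gradients -/

/-- `g` is an unbiased stochastic gradient oracle for the gradient field `f'` on the domain `W`, with
variance at most `σ ^ 2`; a call at `w` returns `g w z`, where the seed `z` has law `P`. The variance
is a lower Lebesgue integral, so no integrability convention is involved in bounding it. -/
structure IsGradientOracle {E Ξ : Type*} [NormedAddCommGroup E] [NormedSpace ℝ E]
    [MeasurableSpace E] [MeasurableSpace Ξ] (W : Set E) (f' : E → E) (σ : ℝ) (P : Measure Ξ)
    (g : E → Ξ → E) : Prop where
  measurable : Measurable (fun p : W × Ξ => g p.1 p.2)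
  integrable : ∀ w ∈ W, Integrable (g w) P
  unbiased : ∀ w ∈ W, ∫ z, g w z ∂P = f' w
  variance : ∀ w ∈ W, ∫⁻ z, ENNReal.ofReal (‖g w z - f' w‖ ^ 2) ∂P ≤ ENNReal.ofReal (σ ^ 2)

/-- The seeds `ξ 1, ξ 2, …` are independent with common law `P`. -/
structure IsIIDSeeds {Ω Ξ : Type*} [MeasurableSpace Ω] [MeasurableSpace Ξ] (μ : Measure Ω)
    (P : Measure Ξ) (ξ : ℕ → Ω → Ξ) : Prop where
  measurable : ∀ t, Measurable (ξ t)
  indep : iIndepFun ξ μ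
  law : ∀ t, μ.map (ξ t) = P

/-- `R` is uniformly distributed on `{1, …, K}` (no condition on the law when `K = 0`) and
independent of the seeds `ξ`. -/
structure IsUniformIndex {Ω Ξ : Type*} [MeasurableSpace Ω] [MeasurableSpace Ξ] (μ : Measure Ω)
    (ξ : ℕ → Ω → Ξ) (K : ℕ) (R : Ω → ℕ) : Prop where
  measurable : Measurable R
  indep : IndepFun R (fun ω t => ξ t ω) μ
  law : ∀ k ∈ Finset.Icc 1 K, μ.real (R ⁻¹' {k}) = 1 / (K : ℝ)

/-! ### Delays -/

/-- The delay of each round `t ∈ {1, …, T}` refers to one of the rounds `1, …, t`. -/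
def IsDelaySequence (T : ℕ) (d : ℕ → ℕ) : Prop :=
  ∀ t ∈ Finset.Icc 1 T, d t < t

/-- `τ` is a `q`-quantile of `d 1, …, d T`: under the uniform distribution on the rounds,
`Pr (d ≤ τ) ≥ q` and `Pr (d ≥ τ) ≥ 1 - q`; the `1`-quantile is the maximal delay. -/
structure IsQuantileDelay (T : ℕ) (d : ℕ → ℕ) (q τ : ℝ) : Prop where
  nonneg : 0 ≤ τ
  le_prob : q ≤ (((Finset.Icc 1 T).filter (fun t => (d t : ℝ) ≤ τ)).card : ℝ) / (T : ℝ)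
  ge_prob : 1 - q ≤ (((Finset.Icc 1 T).filter (fun t => τ ≤ (d t : ℝ))).card : ℝ) / (T : ℝ)
  eq_max : q = 1 → IsGreatest ((fun t : ℕ => (d t : ℝ)) '' Set.Icc 1 T) τ

/-! ### First-order algorithms and asynchronous mini-batching -/

/-- A first-order algorithm: `query l` is the next query point after the responses in the list `l`
(oldest first), and `output l` is the point returned when `l` is the list of all responses. -/
structure FirstOrderAlgorithm (E : Type*) where
  query : List E → E
  output : List E → E

/-- State of asynchronous mini-batching between two rounds. -/
structure MiniBatchState (E : Type*) where
  /-- `played s` is the model `w_s` of each round `s` so far -/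
  played : ℕ → E
  /-- the mini-batch gradients sent to the algorithm so far -/
  responses : List E
  /-- `t_k`, the first round in which the current query is played -/
  start : ℕ
  /-- `b`, the number of gradients accepted for the current query -/
  count : ℕ
  /-- the partial mini-batch gradient of the current query -/
  acc : E

/-- Round `t` of asynchronous mini-batching with `K` queries and batch size `B`. The current query is
played as `w_t`; the gradient `oracle w_{t-d}` with delay `d` is received and is accepted if and only
if `t_k ≤ t - d`; when `B` gradients have been accepted, the mini-batch gradient is sent to the
algorithm and the next query starts at round `t + 1`. After `K` responses nothing happens. -/
def miniBatchRound {E : Type*} [AddCommGroup E] [Module ℝ E] (A : FirstOrderAlgorithm E)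
    (K B : ℕ) (t d : ℕ) (oracle : E → E) (s : MiniBatchState E) : MiniBatchState E :=
  if s.responses.length < K then
    let played := Function.update s.played t (A.query s.responses)
    if s.start ≤ t - d then
      let acc := s.acc + (1 / (B : ℝ)) • oracle (played (t - d))
      if s.count + 1 < B then
        { s with played := played, count := s.count + 1, acc := acc }
      else
        { played := played, responses := s.responses ++ [acc], start := t + 1, count := 0, acc := 0 }
    else
      { s with played := played }
  else s

/-- State after rounds `1, …, t`; `z t` is the seed of the gradient received in round `t`. -/
def miniBatchState {E Ξ : Type*} [AddCommGroup E] [Module ℝ E] (A : FirstOrderAlgorithm E)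
    (K B : ℕ) (d : ℕ → ℕ) (g : E → Ξ → E) (z : ℕ → Ξ) : ℕ → MiniBatchState E
  | 0 => { played := fun _ => 0, responses := [], start := 1, count := 0, acc := 0 }
  | t + 1 => miniBatchRound A K B (t + 1) (d (t + 1)) (fun w => g w (z (t + 1)))
      (miniBatchState A K B d g z t)

/-- Output of asynchronous mini-batching within `T` rounds: the output of the algorithm if all of its
`K` queries have been answered, and `none` otherwise. -/
def asyncMiniBatch {E Ξ : Type*} [AddCommGroup E] [Module ℝ E] (A : FirstOrderAlgorithm E)
    (K B T : ℕ) (d : ℕ → ℕ) (g : E → Ξ → E) (z : ℕ → Ξ) : Option E :=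
  let s := miniBatchState A K B d g z T
  if s.responses.length = K then some (A.output s.responses) else none

/-- Batch size `max {1, τ}` (rounded up if it is not an integer). -/
def batchSize (τ : ℝ) : ℕ := ⌈max 1 τ⌉₊

/-- Number of queries `⌊q T / (1 + 2 τ)⌋`. -/
def numQueries (q τ : ℝ) (T : ℕ) : ℕ := ⌊q * (T : ℝ) / (1 + 2 * τ)⌋₊

/-- Standard deviation bound `σ / √(max {1, τ})` of the mini-batch gradients. -/
def batchStd (σ τ : ℝ) : ℝ := σ / √(max 1 τ)

/-! ### SGD -/

/-- SGD iterate `w_{k+1}` after the `k` responses in the list. -/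
def sgdIterate {E : Type*} [AddCommGroup E] [Module ℝ E] (γ : ℝ) (w₁ : E) (l : List E) : E :=
  l.foldl (fun w v => w - γ • v) w₁

/-- SGD with constant step size `γ` that returns the iterate `w_r`. -/
def sgd {E : Type*} [AddCommGroup E] [Module ℝ E] (γ : ℝ) (w₁ : E) (r : ℕ) :
    FirstOrderAlgorithm E where
  query := sgdIterate γ w₁
  output l := sgdIterate γ w₁ (l.take (r - 1))

/-- Non-convex step size `min {1 / β, √(2 F / (s² β K))}`, which is `1 / β` if `s = 0`. -/
def sgdStepNonconvex (β F s : ℝ) (K : ℕ) : ℝ :=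
  if s = 0 then 1 / β else min (1 / β) √(2 * F / (s ^ 2 * β * K))

/-- Convex step size `min {1 / β, √(D² / (s² K))}`, which is `1 / β` if `s = 0`. -/
def sgdStepConvex (β D s : ℝ) (K : ℕ) : ℝ :=
  if s = 0 then 1 / β else min (1 / β) √(D ^ 2 / (s ^ 2 * K))

/-! ### Accelerated SGD -/

/-- The pair `(x_t, x̄_t)` of accelerated SGD (AC-SA) after the responses in the list, and the number
`t` of these responses. With `α_t = 2 / (t + 1)` and `γ_t = γ t`, the response `v` in step `t` gives
`x_t = x_{t-1} - γ_t v` and `x̄_t = (1 - α_t) x̄_{t-1} + α_t x_t`. -/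
def acsaIterate {E : Type*} [AddCommGroup E] [Module ℝ E] (γ : ℝ) (w₁ : E) (l : List E) :
    ℕ × E × E :=
  l.foldl (fun p v =>
    let t : ℕ := p.1 + 1
    let α : ℝ := 2 / ((t : ℝ) + 1)
    let x : E := p.2.1 - (γ * (t : ℝ)) • v
    (t, x, (1 - α) • p.2.2 + α • x)) (0, w₁, w₁)

/-- Accelerated SGD: the query of step `t` is `(1 - α_t) x̄_{t-1} + α_t x_{t-1}` and the output is the
last `x̄`. -/
def acsa {E : Type*} [AddCommGroup E] [Module ℝ E] (γ : ℝ) (w₁ : E) : FirstOrderAlgorithm E where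
  query l :=
    let p := acsaIterate γ w₁ l
    let α : ℝ := 2 / (((p.1 + 1 : ℕ) : ℝ) + 1)
    (1 - α) • p.2.2 + α • p.2.1
  output l := (acsaIterate γ w₁ l).2.2

/-- `min {1 / (4 β), √(3 D² / (4 s² K (K + 1)²))}`, which is `1 / (4 β)` if `s = 0`. -/
def acsaStep (β D s : ℝ) (K : ℕ) : ℝ :=
  if s = 0 then 1 / (4 * β)
  else min (1 / (4 * β)) √(3 * D ^ 2 / (4 * s ^ 2 * K * ((K : ℝ) + 1) ^ 2))

/-! ### Projected SGD -/

/-- A point of `W` nearest to `x` (unique if it exists and `W` is a convex subset of a Euclidean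
space; it exists if `W` is closed and nonempty). -/
def nearestPoint {E : Type*} [NormedAddCommGroup E] (W : Set E) (x : E) : E :=
  Classical.epsilon fun y => y ∈ W ∧ ∀ z ∈ W, ‖x - y‖ ≤ ‖x - z‖

/-- Projected SGD iterate `w_{k+1}` after the `k` responses in the list. -/
def psgdIterate {E : Type*} [NormedAddCommGroup E] [NormedSpace ℝ E] (W : Set E) (γ : ℝ) (w₁ : E)
    (l : List E) : E :=
  l.foldl (fun w v => nearestPoint W (w - γ • v)) w₁

/-- Projected SGD with constant step size `γ` that returns the average `(w_1 + ⋯ + w_K) / K` of the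
query points of its `K` steps (and `w_1` if `K = 0`). -/
def psgd {E : Type*} [NormedAddCommGroup E] [NormedSpace ℝ E] (W : Set E) (γ : ℝ) (w₁ : E) :
    FirstOrderAlgorithm E where
  query := psgdIterate W γ w₁
  output l :=
    if l.length = 0 then w₁
    else (1 / (l.length : ℝ)) • ∑ i ∈ Finset.range l.length, psgdIterate W γ w₁ (l.take i)

/-- Step size `D / √((G² + s²) K)`. -/
def psgdStep (D G s : ℝ) (K : ℕ) : ℝ := D / √((G ^ 2 + s ^ 2) * K)

end

set_option linter.unusedSectionVars false

/-! The delays are fixed in advance, so which gradients are accepted for which query is a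
deterministic matter: there are pairwise disjoint sets `S k` of `B` rounds each, the same for all
algorithms, oracles and seeds. Asynchronous mini-batching is thus the algorithm itself, run with
responses that average `B` fresh stochastic gradients at the current query.

Enough queries are answered: let `m = ⌊τ⌋`. While one query is played, a gradient with delay at most
`m` can be rejected only during the first `m` rounds, so a query uses up at most `B + m ≤ 1 + 2τ`
rounds of delay at most `m`. At least `qT` rounds have such a delay, which suffices for `K = ⌊qT /
(1 + 2τ)⌋` queries (`exists_schedule`, `numQueries_mul_le`).

The responses are good: the seeds of a batch are independent of the earlier batches, so a response
is unbiased given the history and has variance at most `σ² / B ≤ s²`. Conditional expectations are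
replaced by orthogonality of the error to every square-integrable function of the history, proved by
Fubini after resampling one coordinate of the product measure
(`IsGradientOracle.isStochasticResponses`).

Each algorithm then has its classical potential: `f(w_k)`, `‖w_k - w*‖²`, or `‖x_k - w*‖² + γ k (k +
1) (f(x̄_k) - f(w*))` for acceleration. A pointwise one-step inequality is integrated, which kills
the term linear in the noise, and summed. The result has the form `γ X ≤ a + b γ²`, for which the
prescribed step size is tuned.

If `K ≥ 1`, then `1 / K` is at most of order `(1 + τ) / (qT)`, while `s² / K` is at most of order
`σ² / (qT)`: averaging over `max {1, τ}` gradients makes up for having fewer queries, so the noise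
term is free of the delay. If `K = 0`, then `qT < 1 + 2τ`, and the noise-free term of the bound
alone covers the error at `w₁`. -/

/-- Responses to the first `k` queries of `A` when the `j`-th response is the average of the
stochastic gradients at the `j`-th query whose seeds are indexed by `S j`. -/
noncomputable def batchResponses {E Ξ : Type*} [AddCommGroup E] [Module ℝ E] (A : FirstOrderAlgorithm E)
    (g : E → Ξ → E) (S : ℕ → Finset ℕ) (B : ℕ) (z : ℕ → Ξ) : ℕ → List E
  | 0 => []
  | k + 1 => batchResponses A g S B z k ++
      [∑ t ∈ S k, (1 / (B : ℝ)) • g (A.query (batchResponses A g S B z k)) (z t)]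

/-! ### The deterministic schedule of accepted gradients. -/

section Schedule

variable {E Ξ : Type*} [AddCommGroup E] [Module ℝ E]

theorem length_batchResponses (A : FirstOrderAlgorithm E) (g : E → Ξ → E) (S : ℕ → Finset ℕ)
    (B : ℕ) (z : ℕ → Ξ) (k : ℕ) : (batchResponses A g S B z k).length = k := by
  induction k with
  | zero => rfl
  | succ k ih => simp [batchResponses, ih]

theorem batchResponses_congr (A : FirstOrderAlgorithm E) (g : E → Ξ → E) {S S' : ℕ → Finset ℕ}
    (B : ℕ) (z : ℕ → Ξ) {k : ℕ} (h : ∀ j < k, S j = S' j) :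
    batchResponses A g S B z k = batchResponses A g S' B z k := by
  induction k with
  | zero => rfl
  | succ k ih =>
    simp only [batchResponses]
    rw [ih fun j hj => h j (by omega), h k (by omega)]

/-- The number of rounds among `1, …, t` with delay at most `m`. -/
def smallDelayCount (d : ℕ → ℕ) (m t : ℕ) : ℕ := ((Finset.Icc 1 t).filter (fun i => d i ≤ m)).card

theorem smallDelayCount_succ (d : ℕ → ℕ) (m t : ℕ) :
    smallDelayCount d m (t + 1) = smallDelayCount d m t + if d (t + 1) ≤ m then 1 else 0 := by
  unfold smallDelayCount
  rw [← Finset.insert_Icc_right_eq_Icc_add_one (by omega), Finset.filter_insert]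
  split_ifs
  · rw [Finset.card_insert_of_notMem (by simp)]
  · rfl

/-- The control flow of asynchronous mini-batching does not depend on the seeds. After round `t`,
`len` queries have been answered, the current one is played since round `start` and has received
`count` gradients, and `S k` is the set of the rounds whose gradients were accepted for the
query `k`. -/
structure IsSchedule (E Ξ : Type*) [AddCommGroup E] [Module ℝ E] (K B m : ℕ) (d : ℕ → ℕ)
    (t len start count : ℕ) (S : ℕ → Finset ℕ) : Prop where
  len_le : len ≤ K
  start_le : start ≤ t + 1
  count_lt : count < B
  subset : ∀ k, S k ⊆ Finset.Icc 1 t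
  empty : ∀ k, len < k → S k = ∅
  card_eq : ∀ k < len, (S k).card = B
  card_len : (S len).card = count
  disjoint : Pairwise (Function.onFun Disjoint S)
  -- Each finished query is charged `B + m` rounds of delay at most `m`; the current one is charged
  -- its accepted gradients and at most `m` rejections, all within `m` rounds of `start`.
  progress : len < K →
    smallDelayCount d m t ≤ len * (B + m) + count + min (t + 1 - start) m
  responses_eq : ∀ (A : FirstOrderAlgorithm E) (g : E → Ξ → E) (z : ℕ → Ξ),
    (miniBatchState A K B d g z t).responses = batchResponses A g S B z len
  start_eq : ∀ (A : FirstOrderAlgorithm E) (g : E → Ξ → E) (z : ℕ → Ξ),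
    (miniBatchState A K B d g z t).start = start
  count_eq : ∀ (A : FirstOrderAlgorithm E) (g : E → Ξ → E) (z : ℕ → Ξ),
    (miniBatchState A K B d g z t).count = count
  acc_eq : ∀ (A : FirstOrderAlgorithm E) (g : E → Ξ → E) (z : ℕ → Ξ),
    (miniBatchState A K B d g z t).acc =
      ∑ i ∈ S len, (1 / (B : ℝ)) • g (A.query (batchResponses A g S B z len)) (z i)
  played_eq : ∀ (A : FirstOrderAlgorithm E) (g : E → Ξ → E) (z : ℕ → Ξ), len < K →
    ∀ i, start ≤ i → i ≤ t →
      (miniBatchState A K B d g z t).played i = A.query (batchResponses A g S B z len)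

theorem isSchedule_zero (K : ℕ) {B : ℕ} (hB : 0 < B) (m : ℕ) (d : ℕ → ℕ) :
    IsSchedule E Ξ K B m d 0 0 1 0 (fun _ => ∅) where
  len_le := by omega
  start_le := by omega
  count_lt := hB
  subset k := by simp
  empty k _ := rfl
  card_eq k hk := by omega
  card_len := rfl
  disjoint i j _ := by simp [Function.onFun]
  progress _ := by simp [smallDelayCount]
  responses_eq A g z := rfl
  start_eq A g z := rfl
  count_eq A g z := rfl
  acc_eq A g z := by simp [miniBatchState]
  played_eq A g z _ i h₁ h₂ := by omega

/-- Four cases: all queries answered, gradient rejected, gradient accepted into an unfinished batch,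
gradient completing the batch. None of the tests that separate them involves a model or a seed. -/
theorem IsSchedule.exists_succ {K B m : ℕ} {d : ℕ → ℕ} {t len start count : ℕ}
    {S : ℕ → Finset ℕ} (h : IsSchedule E Ξ K B m d t len start count S) :
    ∃ len' start' count' S', IsSchedule E Ξ K B m d (t + 1) len' start' count' S' := by
  have hresp_len : ∀ (A : FirstOrderAlgorithm E) (g : E → Ξ → E) (z : ℕ → Ξ),
      (miniBatchState A K B d g z t).responses.length = len := fun A g z => by
    rw [h.responses_eq, length_batchResponses]
  have hsub : ∀ k, S k ⊆ Finset.Icc 1 (t + 1) := fun k =>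
    (h.subset k).trans (Finset.Icc_subset_Icc_right (by omega))
  have hcount := smallDelayCount_succ d m t
  by_cases hK : len < K
  swap
  · have hst : ∀ (A : FirstOrderAlgorithm E) (g : E → Ξ → E) (z : ℕ → Ξ),
        miniBatchState A K B d g z (t + 1) = miniBatchState A K B d g z t := fun A g z => by
      simp only [miniBatchState, miniBatchRound, hresp_len, if_neg hK]
    refine ⟨len, start, count, S, ⟨h.len_le, by have := h.start_le; omega, h.count_lt, hsub,
      h.empty, h.card_eq, h.card_len, h.disjoint, fun hk => absurd hk hK, ?_, ?_, ?_, ?_,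
      fun A g z hk => absurd hk hK⟩⟩ <;> intro A g z <;> rw [hst]
    · exact h.responses_eq A g z
    · exact h.start_eq A g z
    · exact h.count_eq A g z
    · exact h.acc_eq A g z
  have hplayed : ∀ (A : FirstOrderAlgorithm E) (g : E → Ξ → E) (z : ℕ → Ξ) (i : ℕ),
      start ≤ i → i ≤ t + 1 →
      Function.update (miniBatchState A K B d g z t).played (t + 1)
        (A.query (miniBatchState A K B d g z t).responses) i
        = A.query (batchResponses A g S B z len) := by
    intro A g z i h₁ h₂
    rcases eq_or_ne i (t + 1) with rfl | hi
    · rw [Function.update_self, h.responses_eq]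
    · rw [Function.update_of_ne hi, h.played_eq A g z hK i h₁ (by omega)]
  have hprog := h.progress hK
  by_cases hacc : start ≤ t + 1 - d (t + 1)
  swap
  · have hst : ∀ (A : FirstOrderAlgorithm E) (g : E → Ξ → E) (z : ℕ → Ξ),
        miniBatchState A K B d g z (t + 1) = { miniBatchState A K B d g z t with
          played := Function.update (miniBatchState A K B d g z t).played (t + 1)
            (A.query (miniBatchState A K B d g z t).responses) } := fun A g z => by
      simp only [miniBatchState, miniBatchRound, hresp_len, if_pos hK, h.start_eq, if_neg hacc]
    refine ⟨len, start, count, S, ⟨h.len_le, by have := h.start_le; omega, h.count_lt, hsub,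
      h.empty, h.card_eq, h.card_len, h.disjoint, fun hk => ?_, ?_, ?_, ?_, ?_, ?_⟩⟩
    · have := h.start_le
      split_ifs at hcount <;> omega
    all_goals intro A g z; rw [hst]
    · exact h.responses_eq A g z
    · exact h.start_eq A g z
    · exact h.count_eq A g z
    · exact h.acc_eq A g z
    · intro _ i h₁ h₂
      exact hplayed A g z i h₁ h₂
  have hnot : ∀ k, t + 1 ∉ S k := fun k hk => by
    have := h.subset k hk
    simp at this
  set S' : ℕ → Finset ℕ := Function.update S len (insert (t + 1) (S len)) with hS'
  have hS'len : S' len = insert (t + 1) (S len) := by simp [hS']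
  have hS'ne : ∀ k, k ≠ len → S' k = S k := fun k hk => by simp [hS', hk]
  have hS'sub : ∀ k, S' k ⊆ Finset.Icc 1 (t + 1) := fun k => by
    rcases eq_or_ne k len with rfl | hk
    · rw [hS'len]
      exact Finset.insert_subset (by simp) (hsub k)
    · rw [hS'ne k hk]
      exact hsub k
  have hcard : (S' len).card = count + 1 := by
    rw [hS'len, Finset.card_insert_of_notMem (hnot len), h.card_len]
  have hdisj : Pairwise (Function.onFun Disjoint S') := by
    intro i j hij
    have hij' := h.disjoint hij
    simp only [Function.onFun] at hij' ⊢
    rcases eq_or_ne i len with rfl | hi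
    · rw [hS'len, hS'ne j hij.symm, Finset.disjoint_insert_left]
      exact ⟨hnot j, hij'⟩
    · rcases eq_or_ne j len with rfl | hj
      · rw [hS'len, hS'ne i hi, Finset.disjoint_insert_right]
        exact ⟨hnot i, hij'⟩
      · rwa [hS'ne i hi, hS'ne j hj]
  have hresp : ∀ (A : FirstOrderAlgorithm E) (g : E → Ξ → E) (z : ℕ → Ξ),
      batchResponses A g S' B z len = batchResponses A g S B z len := fun A g z =>
    batchResponses_congr A g B z fun j hj => hS'ne j (by omega)
  have hsum : ∀ (A : FirstOrderAlgorithm E) (g : E → Ξ → E) (z : ℕ → Ξ),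
      (miniBatchState A K B d g z t).acc + (1 / (B : ℝ)) •
        g (A.query (batchResponses A g S B z len)) (z (t + 1)) =
      ∑ i ∈ S' len, (1 / (B : ℝ)) • g (A.query (batchResponses A g S' B z len)) (z i) := by
    intro A g z
    rw [hS'len, Finset.sum_insert (hnot len), hresp, h.acc_eq, add_comm]
  -- Acceptance means that the delayed round is not before `start`, so the gradient was taken at the
  -- current query.
  have hquery := fun A g z => hplayed A g z (t + 1 - d (t + 1)) hacc (by omega)
  by_cases hend : count + 1 < B
  · have hst : ∀ (A : FirstOrderAlgorithm E) (g : E → Ξ → E) (z : ℕ → Ξ),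
        miniBatchState A K B d g z (t + 1) = { miniBatchState A K B d g z t with
          played := Function.update (miniBatchState A K B d g z t).played (t + 1)
            (A.query (miniBatchState A K B d g z t).responses)
          count := count + 1
          acc := ∑ i ∈ S' len,
            (1 / (B : ℝ)) • g (A.query (batchResponses A g S' B z len)) (z i) } := fun A g z => by
      simp only [miniBatchState, miniBatchRound, hresp_len, if_pos hK, h.start_eq, if_pos hacc,
        h.count_eq, if_pos hend, hquery, hsum]
    refine ⟨len, start, count + 1, S', ⟨h.len_le, by have := h.start_le; omega, hend, hS'sub,
      fun k hk => by rw [hS'ne k (by omega)]; exact h.empty k hk,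
      fun k hk => by rw [hS'ne k (by omega)]; exact h.card_eq k hk, hcard, hdisj,
      fun hk => ?_, ?_, ?_, ?_, ?_, ?_⟩⟩
    · have := h.start_le
      split_ifs at hcount <;> omega
    all_goals intro A g z; rw [hst]
    · rw [hresp]
      exact h.responses_eq A g z
    · exact h.start_eq A g z
    · intro _ i h₁ h₂
      rw [hresp]
      exact hplayed A g z i h₁ h₂
  · have hBc : count + 1 = B := by have := h.count_lt; omega
    have hst : ∀ (A : FirstOrderAlgorithm E) (g : E → Ξ → E) (z : ℕ → Ξ),
        miniBatchState A K B d g z (t + 1) = {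
          played := Function.update (miniBatchState A K B d g z t).played (t + 1)
            (A.query (miniBatchState A K B d g z t).responses)
          responses := batchResponses A g S' B z (len + 1)
          start := t + 2
          count := 0
          acc := 0 } := fun A g z => by
      simp only [miniBatchState, miniBatchRound, hresp_len, if_pos hK, h.start_eq, if_pos hacc,
        h.count_eq, if_neg hend, hquery, hsum, batchResponses]
      rw [h.responses_eq, hresp]
    have hempty : S' (len + 1) = ∅ := by
      rw [hS'ne _ (by omega)]
      exact h.empty _ (by omega)
    refine ⟨len + 1, t + 2, 0, S', ⟨hK, by omega, by omega, hS'sub,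
      fun k hk => by rw [hS'ne k (by omega)]; exact h.empty k (by omega), fun k hk => ?_,
      by rw [hempty]; rfl, hdisj, fun hk => ?_, ?_, ?_, ?_, ?_, ?_⟩⟩
    · rcases eq_or_ne k len with rfl | hk'
      · rw [hcard, hBc]
      · rw [hS'ne k hk']
        exact h.card_eq k (by omega)
    · have : (len + 1) * (B + m) = len * (B + m) + (B + m) := by ring
      split_ifs at hcount <;> omega
    all_goals intro A g z; rw [hst]
    · rw [hempty]
      rfl
    · intro _ i h₁ h₂
      omega

theorem exists_isSchedule (E Ξ : Type*) [AddCommGroup E] [Module ℝ E] (K : ℕ) {B : ℕ}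
    (hB : 0 < B) (m : ℕ) (d : ℕ → ℕ) (t : ℕ) :
    ∃ len start count S, IsSchedule E Ξ K B m d t len start count S := by
  induction t with
  | zero => exact ⟨0, 1, 0, _, isSchedule_zero K hB m d⟩
  | succ t ih =>
    obtain ⟨len, start, count, S, h⟩ := ih
    exact h.exists_succ

/-- If only `len < K` queries were answered, `progress` and `count < B` would leave fewer than `(len
+ 1) * (B + m)` rounds of delay at most `m`. The sets `S` are chosen before `A`, `g` and `z`, so one
schedule serves every outcome, including every value of the random output index. -/
theorem exists_schedule (E Ξ : Type*) [AddCommGroup E] [Module ℝ E] {K B m T : ℕ} {d : ℕ → ℕ}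
    (hB : 0 < B) (hT : K * (B + m) ≤ smallDelayCount d m T) :
    ∃ S : ℕ → Finset ℕ, (∀ k < K, (S k).card = B) ∧ Pairwise (Function.onFun Disjoint S) ∧
      ∀ (A : FirstOrderAlgorithm E) (g : E → Ξ → E) (z : ℕ → Ξ),
        asyncMiniBatch A K B T d g z = some (A.output (batchResponses A g S B z K)) := by
  obtain ⟨len, start, count, S, h⟩ := exists_isSchedule E Ξ K hB m d T
  have hlen : len = K := by
    refine le_antisymm h.len_le (not_lt.1 fun hlt => ?_)
    have h₁ := h.progress hlt
    have h₂ := h.count_lt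
    have h₃ : (len + 1) * (B + m) ≤ K * (B + m) := Nat.mul_le_mul_right _ hlt
    have h₄ : (len + 1) * (B + m) = len * (B + m) + (B + m) := by ring
    omega
  subst hlen
  refine ⟨S, h.card_eq, h.disjoint, fun A g z => ?_⟩
  simp only [asyncMiniBatch, h.responses_eq, length_batchResponses, if_true]

end Schedule

/-! ### Batch size and number of queries against the quantile delay. -/

theorem batchSize_pos (τ : ℝ) : 0 < batchSize τ :=
  Nat.ceil_pos.2 (lt_of_lt_of_le one_pos (le_max_left _ _))

theorem le_batchSize (τ : ℝ) : max 1 τ ≤ batchSize τ := Nat.le_ceil _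

/-- For `τ ≥ 1` the sum is at most `2⌊τ⌋ + 1`; for `τ < 1` it is `1 + 0`. The rounding of the batch
size is thus offset by that of the delay threshold. -/
theorem batchSize_add_floor_le {τ : ℝ} (hτ : 0 ≤ τ) :
    (batchSize τ : ℝ) + ⌊τ⌋₊ ≤ 1 + 2 * τ := by
  have hfl := Nat.floor_le hτ
  rcases le_or_gt 1 τ with h | h
  · have h₁ : (⌈τ⌉₊ : ℝ) ≤ ⌊τ⌋₊ + 1 := by exact_mod_cast Nat.ceil_le_floor_add_one τ
    rw [batchSize, max_eq_right h]
    linarith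
  · rw [batchSize, max_eq_left h.le, Nat.ceil_one, Nat.floor_eq_zero.2 h]
    simp [hτ]

theorem numQueries_mul_le {T : ℕ} {d : ℕ → ℕ} {q τq τ : ℝ} (hT : 0 < T) (hq : 0 < q)
    (hd : IsQuantileDelay T d q τq) (hτ : τq ≤ τ) :
    numQueries q τ T * (batchSize τ + ⌊τ⌋₊) ≤ smallDelayCount d ⌊τ⌋₊ T := by
  have hτ0 : 0 ≤ τ := hd.nonneg.trans hτ
  have hT' : (0 : ℝ) < T := by exact_mod_cast hT
  have h₁ : q * T ≤ smallDelayCount d ⌊τ⌋₊ T := by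
    refine ((le_div_iff₀ hT').1 hd.le_prob).trans ?_
    unfold smallDelayCount
    norm_cast
    refine Finset.card_le_card fun t ht => ?_
    rw [Finset.mem_filter] at ht ⊢
    exact ⟨ht.1, Nat.le_floor (ht.2.trans hτ)⟩
  have h₂ : (numQueries q τ T : ℝ) ≤ q * T / (1 + 2 * τ) := Nat.floor_le (by positivity)
  rw [le_div_iff₀ (by positivity)] at h₂
  have h₃ : (numQueries q τ T : ℝ) * (batchSize τ + ⌊τ⌋₊) ≤ numQueries q τ T * (1 + 2 * τ) :=
    mul_le_mul_of_nonneg_left (batchSize_add_floor_le hτ0) (by positivity)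
  exact_mod_cast h₃.trans (h₂.trans h₁)

/-! ### The seeds as a product measure. -/

section Seeds

variable {Ξ : Type*} [MeasurableSpace Ξ]

/-- Resampling one seed independently leaves the law unchanged. Together with Fubini this does the
work of conditioning on all the other seeds. -/
theorem measurePreserving_update_infinitePi (P : Measure Ξ) [IsProbabilityMeasure P] (t : ℕ) :
    MeasurePreserving (fun p : (ℕ → Ξ) × Ξ => Function.update p.1 t p.2)
      ((Measure.infinitePi fun _ : ℕ => P).prod P) (Measure.infinitePi fun _ : ℕ => P) := by
  have hm : Measurable (fun p : (ℕ → Ξ) × Ξ => Function.update p.1 t p.2) := by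
    rw [measurable_pi_iff]
    intro i
    rcases eq_or_ne i t with rfl | hi
    · simpa using measurable_snd
    · simpa [hi, Function.comp_def] using
        (measurable_pi_apply (X := fun _ : ℕ => Ξ) i).comp (measurable_fst (β := Ξ))
  refine ⟨hm, Measure.eq_infinitePi _ fun s box hbox => ?_⟩
  rw [Measure.map_apply hm (MeasurableSet.pi s.countable_toSet fun i hi => hbox i)]
  have hpre : (fun p : (ℕ → Ξ) × Ξ => Function.update p.1 t p.2) ⁻¹' Set.pi s box =
      (Set.pi (s.erase t) box) ×ˢ (if t ∈ s then box t else Set.univ) := by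
    ext ⟨z, ζ⟩
    simp only [Set.mem_preimage, Set.mem_pi, Finset.mem_coe, Set.mem_prod, Finset.mem_erase]
    constructor
    · intro h
      refine ⟨fun i hi => by simpa [hi.1] using h i hi.2, ?_⟩
      split_ifs with ht
      · simpa using h t ht
      · trivial
    · rintro ⟨h₁, h₂⟩ i hi
      rcases eq_or_ne i t with rfl | hit
      · simpa [hi] using h₂
      · simpa [hit] using h₁ i ⟨hit, hi⟩
  rw [hpre, Measure.prod_prod, Measure.infinitePi_pi _ fun i _ => hbox i]
  split_ifs with ht
  · rw [mul_comm, Finset.mul_prod_erase s (fun i => P (box i)) ht]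
  · rw [Finset.erase_eq_of_notMem ht, measure_univ, mul_one]

theorem IsIIDSeeds.map_eq_infinitePi {Ω : Type*} [MeasurableSpace Ω] {μ : Measure Ω}
    [IsProbabilityMeasure μ] {P : Measure Ξ} {ξ : ℕ → Ω → Ξ} (h : IsIIDSeeds μ P ξ) :
    μ.map (fun ω t => ξ t ω) = Measure.infinitePi fun _ : ℕ => P := by
  have := fun t => Measure.isProbabilityMeasure_map (μ := μ) (h.measurable t).aemeasurable
  rw [(iIndepFun_iff_map_fun_eq_infinitePi_map h.measurable).1 h.indep]
  simp_rw [h.law]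

end Seeds

/-! ### Noise of one gradient at a query that does not depend on its seed. -/

section Oracle

variable {E Ξ : Type*} [NormedAddCommGroup E] [InnerProductSpace ℝ E] [CompleteSpace E]
  [MeasurableSpace E] [BorelSpace E] [SecondCountableTopology E] [MeasurableSpace Ξ]
  {W : Set E} {f' : E → E} {σ : ℝ} {P : Measure Ξ} [IsProbabilityMeasure P] {g : E → Ξ → E}

theorem IsGradientOracle.measurable_comp {α : Type*} [MeasurableSpace α]
    (hg : IsGradientOracle W f' σ P g) {Q : α → E} (hQ : Measurable Q) (hQW : ∀ z, Q z ∈ W)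
    {X : α → Ξ} (hX : Measurable X) : Measurable fun z => g (Q z) (X z) :=
  hg.measurable.comp ((hQ.subtype_mk (h := hQW)).prodMk hX)

/-- No measurability of `f'` is assumed: it is inherited from the jointly measurable oracle, of
which `f'` is the partial integral. -/
theorem IsGradientOracle.measurable_gradient_comp {α : Type*} [MeasurableSpace α]
    (hg : IsGradientOracle W f' σ P g) {Q : α → E} (hQ : Measurable Q) (hQW : ∀ z, Q z ∈ W) :
    Measurable fun z => f' (Q z) := by
  have h := hg.measurable_comp (hQ.comp (measurable_fst (β := Ξ))) (fun p => hQW p.1)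
    (measurable_snd (α := α))
  have h' := (h.stronglyMeasurable.integral_prod_right' (ν := P)).measurable
  convert h' using 2 with z
  exact (hg.unbiased _ (hQW z)).symm

variable {Q : (ℕ → Ξ) → E} {t : ℕ}

theorem IsGradientOracle.measurable_noise (hg : IsGradientOracle W f' σ P g) (hQ : Measurable Q)
    (hQW : ∀ z, Q z ∈ W) : Measurable fun z => g (Q z) (z t) - f' (Q z) :=
  (hg.measurable_comp hQ hQW (measurable_pi_apply t)).sub (hg.measurable_gradient_comp hQ hQW)

/-- After seed `t` is resampled, `Q` does not move, so the inner integral is the oracle's variance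
at a fixed point of `W`. -/
theorem IsGradientOracle.lintegral_noise_le (hg : IsGradientOracle W f' σ P g) (hQ : Measurable Q)
    (hQW : ∀ z, Q z ∈ W) (hQt : ∀ z ζ, Q (Function.update z t ζ) = Q z) :
    ∫⁻ z, ENNReal.ofReal (‖g (Q z) (z t) - f' (Q z)‖ ^ 2) ∂(Measure.infinitePi fun _ : ℕ => P) ≤
      ENNReal.ofReal (σ ^ 2) := by
  have hm : Measurable fun z : ℕ → Ξ => ENNReal.ofReal (‖g (Q z) (z t) - f' (Q z)‖ ^ 2) :=
    ((hg.measurable_noise hQ hQW).norm.pow_const 2).ennreal_ofReal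
  have hmp := measurePreserving_update_infinitePi P t
  have hm' := hm.comp hmp.measurable
  simp only [Function.comp_def] at hm'
  rw [← hmp.lintegral_comp hm, lintegral_prod _ hm'.aemeasurable]
  simp only [hQt, Function.update_self]
  refine (lintegral_mono fun z => hg.variance _ (hQW z)).trans ?_
  simp

theorem IsGradientOracle.memLp_noise (hg : IsGradientOracle W f' σ P g) (hQ : Measurable Q)
    (hQW : ∀ z, Q z ∈ W) (hQt : ∀ z ζ, Q (Function.update z t ζ) = Q z) :
    MemLp (fun z => g (Q z) (z t) - f' (Q z)) 2 (Measure.infinitePi fun _ : ℕ => P) := by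
  have hm := hg.measurable_noise (t := t) hQ hQW
  refine (memLp_two_iff_integrable_sq_norm hm.aestronglyMeasurable).2
    ⟨(hm.norm.pow_const 2).aestronglyMeasurable, ?_⟩
  rw [hasFiniteIntegral_iff_ofReal (ae_of_all _ fun z => by positivity)]
  exact (hg.lintegral_noise_le hQ hQW hQt).trans_lt ENNReal.ofReal_lt_top

theorem IsGradientOracle.integral_noise_sq_le (hg : IsGradientOracle W f' σ P g)
    (hQ : Measurable Q) (hQW : ∀ z, Q z ∈ W) (hQt : ∀ z ζ, Q (Function.update z t ζ) = Q z) :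
    ∫ z, ‖g (Q z) (z t) - f' (Q z)‖ ^ 2 ∂(Measure.infinitePi fun _ : ℕ => P) ≤ σ ^ 2 := by
  have hm := hg.measurable_noise (t := t) hQ hQW
  rw [integral_eq_lintegral_of_nonneg_ae (ae_of_all _ fun z => by positivity)
    (hm.norm.pow_const 2).aestronglyMeasurable]
  exact ENNReal.toReal_le_of_le_ofReal (by positivity) (hg.lintegral_noise_le hQ hQW hQt)

theorem integrable_inner_of_memLp_two {α : Type*} [MeasurableSpace α] {ν : Measure α}
    {X Y : α → E} (hX : MemLp X 2 ν) (hY : MemLp Y 2 ν) :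
    Integrable (fun z => inner ℝ (X z) (Y z)) ν := by
  refine Integrable.mono' (hX.norm.integrable_mul hY.norm) (hX.1.inner hY.1)
    (ae_of_all _ fun z => norm_inner_le_norm _ _)

/-- Neither `Q` nor `Y` sees seed `t`. Integrating over that seed first leaves the inner product of
`Y` with the mean of the noise, which is zero. -/
theorem IsGradientOracle.integral_inner_noise (hg : IsGradientOracle W f' σ P g)
    (hQ : Measurable Q) (hQW : ∀ z, Q z ∈ W) (hQt : ∀ z ζ, Q (Function.update z t ζ) = Q z)
    {Y : (ℕ → Ξ) → E} (hY : MemLp Y 2 (Measure.infinitePi fun _ : ℕ => P))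
    (hYt : ∀ z ζ, Y (Function.update z t ζ) = Y z) :
    ∫ z, inner ℝ (g (Q z) (z t) - f' (Q z)) (Y z) ∂(Measure.infinitePi fun _ : ℕ => P) = 0 := by
  have hint := integrable_inner_of_memLp_two (hg.memLp_noise hQ hQW hQt) hY
  have hmp := measurePreserving_update_infinitePi P t
  have hint' := hmp.integrable_comp_of_integrable hint
  simp only [Function.comp_def] at hint'
  have hmap := integral_map hmp.measurable.aemeasurable (hmp.map_eq.symm ▸ hint.1)
  rw [hmp.map_eq] at hmap
  rw [hmap, integral_prod _ hint']
  simp only [hQt, hYt, Function.update_self]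
  refine integral_eq_zero_of_ae (ae_of_all _ fun z => ?_)
  have hi := (hg.integrable _ (hQW z)).sub (integrable_const (f' (Q z)))
  have := integral_inner (𝕜 := ℝ) hi (Y z)
  simp only [Pi.sub_apply] at this
  simp only [Pi.zero_apply]
  simp_rw [real_inner_comm (Y z)]
  rw [this, integral_sub (hg.integrable _ (hQW z)) (integrable_const _), hg.unbiased _ (hQW z)]
  simp

end Oracle

/-! ### Mini-batch responses as unbiased gradient estimates. -/

/-- The list `V 0 z, …, V (k - 1) z`. -/
def history {E α : Type*} (V : ℕ → α → E) (k : ℕ) (z : α) : List E :=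
  (List.range k).map fun j => V j z

theorem history_zero {E α : Type*} (V : ℕ → α → E) (z : α) : history V 0 z = [] := rfl

theorem history_succ {E α : Type*} (V : ℕ → α → E) (k : ℕ) (z : α) :
    history V (k + 1) z = history V k z ++ [V k z] := by
  simp [history, List.range_succ]

theorem length_history {E α : Type*} (V : ℕ → α → E) (k : ℕ) (z : α) :
    (history V k z).length = k := by
  simp [history]

theorem take_history {E α : Type*} (V : ℕ → α → E) (i k : ℕ) (z : α) :
    (history V k z).take i = history V (min i k) z := by
  simp [history, ← List.map_take, List.take_range]

/-- `V k` is the response to the `k`-th query of `A`: its error as an estimate of the gradient at the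
query has second moment at most `s ^ 2` for `k < K` and is orthogonal to all square-integrable
functions of the earlier responses. -/
structure IsStochasticResponses {E Z : Type*} [NormedAddCommGroup E] [InnerProductSpace ℝ E]
    [MeasurableSpace E] [MeasurableSpace Z] (ν : Measure Z) (A : FirstOrderAlgorithm E)
    (f' : E → E) (s : ℝ) (K : ℕ) (V : ℕ → Z → E) : Prop where
  measurable : ∀ k, Measurable (V k)
  memLp : ∀ k < K, MemLp (fun z => V k z - f' (A.query (history V k z))) 2 ν
  variance : ∀ k < K, ∫ z, ‖V k z - f' (A.query (history V k z))‖ ^ 2 ∂ν ≤ s ^ 2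
  unbiased : ∀ k < K, ∀ φ : List E → E, MemLp (fun z => φ (history V k z)) 2 ν →
    ∫ z, inner ℝ (V k z - f' (A.query (history V k z))) (φ (history V k z)) ∂ν = 0

section Batches

variable {E Ξ : Type*} [NormedAddCommGroup E] [InnerProductSpace ℝ E]

/-- The average of the gradients at the `k`-th query of `A` with seeds `z t`, `t ∈ S k`. -/
noncomputable def batchGradient (A : FirstOrderAlgorithm E) (g : E → Ξ → E) (S : ℕ → Finset ℕ)
    (B k : ℕ) (z : ℕ → Ξ) : E :=
  ∑ t ∈ S k, (1 / (B : ℝ)) • g (A.query (batchResponses A g S B z k)) (z t)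

theorem batchResponses_eq_history (A : FirstOrderAlgorithm E) (g : E → Ξ → E) (S : ℕ → Finset ℕ)
    (B : ℕ) (z : ℕ → Ξ) (k : ℕ) :
    batchResponses A g S B z k = history (batchGradient A g S B) k z := by
  induction k with
  | zero => rfl
  | succ k ih => rw [history_succ, ← ih]; rfl

theorem batchResponses_update (A : FirstOrderAlgorithm E) (g : E → Ξ → E) {S : ℕ → Finset ℕ}
    (B : ℕ) {k t : ℕ} (ht : ∀ j < k, t ∉ S j) (z : ℕ → Ξ) (ζ : Ξ) :
    batchResponses A g S B (Function.update z t ζ) k = batchResponses A g S B z k := by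
  induction k with
  | zero => rfl
  | succ k ih =>
    simp only [batchResponses]
    rw [ih fun j hj => ht j (by omega)]
    congr 2
    refine Finset.sum_congr rfl fun i hi => ?_
    have hit : i ≠ t := fun h => ht k (by omega) (h ▸ hi)
    rw [Function.update_of_ne hit]

variable [CompleteSpace E] [MeasurableSpace E] [BorelSpace E] [SecondCountableTopology E]
  [MeasurableSpace Ξ] {W : Set E} {f' : E → E} {σ : ℝ} {P : Measure Ξ} [IsProbabilityMeasure P]
  {g : E → Ξ → E}

theorem integral_norm_sum_sq {α ι : Type*} [MeasurableSpace α] {ν : Measure α} (S : Finset ι)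
    {X : ι → α → E} (hX : ∀ i ∈ S, MemLp (X i) 2 ν)
    (hXX : ∀ i ∈ S, ∀ j ∈ S, i ≠ j → ∫ z, inner ℝ (X i z) (X j z) ∂ν = 0) :
    ∫ z, ‖∑ i ∈ S, X i z‖ ^ 2 ∂ν = ∑ i ∈ S, ∫ z, ‖X i z‖ ^ 2 ∂ν := by
  have hint : ∀ i ∈ S, ∀ j ∈ S, Integrable (fun z => inner ℝ (X i z) (X j z)) ν :=
    fun i hi j hj => integrable_inner_of_memLp_two (hX i hi) (hX j hj)
  simp_rw [← real_inner_self_eq_norm_sq, sum_inner, inner_sum]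
  rw [integral_finsetSum _ fun i hi => integrable_finsetSum _ (hint i hi)]
  refine Finset.sum_congr rfl fun i hi => ?_
  rw [integral_finsetSum _ (hint i hi)]
  exact Finset.sum_eq_single_of_mem i hi fun j hj hji => hXX i hi j hj hji.symm

/-- By disjointness of the batches, the history before query `k` depends on no seed in `S k`, so
every noise term of batch `k` is orthogonal to functions of that history. The terms of one batch are
also mutually orthogonal, and the variance of their average is at most `σ² / B`. -/
theorem IsGradientOracle.isStochasticResponses (hg : IsGradientOracle W f' σ P g)
    {A : FirstOrderAlgorithm E} (hAW : ∀ l, A.query l ∈ W)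
    (hA : ∀ (V : ℕ → (ℕ → Ξ) → E) (k : ℕ), (∀ j < k, Measurable (V j)) →
      Measurable fun z => A.query (history V k z))
    {S : ℕ → Finset ℕ} {B K : ℕ} (hB : 0 < B) (hcard : ∀ k < K, (S k).card = B)
    (hdisj : Pairwise (Function.onFun Disjoint S)) {s : ℝ} (hs : σ ^ 2 ≤ B * s ^ 2) :
    IsStochasticResponses (Measure.infinitePi fun _ : ℕ => P) A f' s K
      (batchGradient A g S B) := by
  have hBr : (0 : ℝ) < B := by exact_mod_cast hB
  have hV : ∀ k, Measurable (batchGradient A g S B k) := fun k => by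
    induction k using Nat.strong_induction_on with
    | _ k ih =>
      refine Finset.measurable_sum _ fun t _ => Measurable.const_smul ?_ _
      have hQ := hA _ k ih
      simp only [← batchResponses_eq_history] at hQ
      exact hg.measurable_comp hQ (fun z => hAW _) (measurable_pi_apply t)
  have hQ : ∀ k, Measurable fun z => A.query (history (batchGradient A g S B) k z) :=
    fun k => hA _ k fun j _ => hV j
  have hQW : ∀ k z, A.query (history (batchGradient A g S B) k z) ∈ W := fun k z => hAW _
  have hhist : ∀ k, ∀ t ∈ S k, ∀ z ζ, history (batchGradient A g S B) k (Function.update z t ζ) =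
      history (batchGradient A g S B) k z := fun k t ht z ζ => by
    rw [← batchResponses_eq_history, ← batchResponses_eq_history]
    refine batchResponses_update A g B (fun j hj h => ?_) z ζ
    exact Finset.disjoint_left.1 (hdisj hj.ne) h ht
  set δ : ℕ → ℕ → (ℕ → Ξ) → E := fun k t z =>
    g (A.query (history (batchGradient A g S B) k z)) (z t) -
      f' (A.query (history (batchGradient A g S B) k z)) with hδ
  have hQt : ∀ k, ∀ t ∈ S k, ∀ z ζ,
      A.query (history (batchGradient A g S B) k (Function.update z t ζ)) =
      A.query (history (batchGradient A g S B) k z) := fun k t ht z ζ => by rw [hhist k t ht]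
  have hδL : ∀ k, ∀ t ∈ S k, MemLp (δ k t) 2 (Measure.infinitePi fun _ : ℕ => P) :=
    fun k t ht => hg.memLp_noise (hQ k) (hQW k) (hQt k t ht)
  have herr : ∀ k < K, ∀ z, batchGradient A g S B k z -
      f' (A.query (history (batchGradient A g S B) k z)) =
      ∑ t ∈ S k, (1 / (B : ℝ)) • δ k t z := fun k hk z => by
    simp only [hδ, smul_sub, Finset.sum_sub_distrib]
    rw [Finset.sum_const, hcard k hk, ← Nat.cast_smul_eq_nsmul ℝ, smul_smul,
      mul_one_div_cancel hBr.ne', one_smul, ← batchResponses_eq_history]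
    rfl
  have hδL' : ∀ k, ∀ t ∈ S k, MemLp (fun z => (1 / (B : ℝ)) • δ k t z) 2
      (Measure.infinitePi fun _ : ℕ => P) := fun k t ht => (hδL k t ht).const_smul _
  refine ⟨hV, fun k hk => ?_, fun k hk => ?_, fun k hk φ hφ => ?_⟩
  · simp_rw [herr k hk]
    exact memLp_finsetSum _ (hδL' k)
  · simp_rw [herr k hk]
    rw [integral_norm_sum_sq _ (hδL' k)]
    · have h₁ : ∀ t ∈ S k, ∫ z, ‖(1 / (B : ℝ)) • δ k t z‖ ^ 2
          ∂(Measure.infinitePi fun _ : ℕ => P) ≤ (1 / (B : ℝ)) ^ 2 * σ ^ 2 := fun t ht => by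
        simp_rw [norm_smul, mul_pow]
        rw [integral_const_mul, Real.norm_of_nonneg (by positivity)]
        exact mul_le_mul_of_nonneg_left
          (hg.integral_noise_sq_le (hQ k) (hQW k) (hQt k t ht)) (by positivity)
      refine (Finset.sum_le_sum h₁).trans ?_
      rw [Finset.sum_const, hcard k hk, nsmul_eq_mul]
      have : (B : ℝ) * ((1 / (B : ℝ)) ^ 2 * σ ^ 2) = σ ^ 2 / B := by field_simp
      rw [this, div_le_iff₀ hBr]
      linarith
    -- Seed `i` is the one integrated out: the noise of seed `j` does not depend on it, since the
    -- common query does not.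
    · intro i hi j hj hij
      simp_rw [inner_smul_left, inner_smul_right]
      rw [integral_const_mul, integral_const_mul]
      have := hg.integral_inner_noise (hQ k) (hQW k) (hQt k i hi) (hδL k j hj) fun z ζ => by
        simp only [hδ]
        rw [hQt k i hi, Function.update_of_ne hij.symm]
      rw [this]
      simp
  · simp_rw [herr k hk, sum_inner, inner_smul_left]
    rw [integral_finsetSum _ fun t ht =>
      (integrable_inner_of_memLp_two (hδL k t ht) hφ).const_mul _]
    refine Finset.sum_eq_zero fun t ht => ?_
    rw [integral_const_mul, hg.integral_inner_noise (hQ k) (hQW k) (hQt k t ht) hφ fun z ζ => by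
      rw [hhist k t ht], mul_zero]

end Batches

/-! ### First-order inequalities for gradients relative to a convex set. -/

section Convexity

variable {E : Type*} [NormedAddCommGroup E] [InnerProductSpace ℝ E] [CompleteSpace E]
  {W : Set E} {f : E → ℝ}

theorem HasGradientWithinAt.hasDerivWithinAt_segment {p x y : E}
    (hf : HasGradientWithinAt f p W x) (hW : Convex ℝ W) (hx : x ∈ W) (hy : y ∈ W) :
    HasDerivWithinAt (fun r : ℝ => f (x + r • (y - x))) (inner ℝ p (y - x)) (Set.Icc 0 1) 0 := by
  have h₁ : HasDerivWithinAt (fun r : ℝ => x + r • (y - x)) (y - x) (Set.Icc 0 1) 0 := by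
    simpa using (((hasDerivAt_id (0 : ℝ)).smul_const (y - x)).const_add x).hasDerivWithinAt
  have h₂ : HasFDerivWithinAt f (InnerProductSpace.toDual ℝ E p) W (x + (0 : ℝ) • (y - x)) := by
    simpa using hf.hasFDerivWithinAt
  have h₃ := h₂.comp_hasDerivWithinAt (0 : ℝ) h₁ fun r hr => hW.add_smul_sub_mem hx hy hr
  simpa [Function.comp_def] using h₃

/-- On the segment from `x` to `y`, the slope of a convex function over `[0, 1]` is at least its
right derivative at `0`. A one-sided derivative is all that a gradient within `W` provides. -/
theorem ConvexOn.add_inner_le {p x y : E} (hf : ConvexOn ℝ W f)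
    (hp : HasGradientWithinAt f p W x) (hx : x ∈ W) (hy : y ∈ W) :
    f x + inner ℝ p (y - x) ≤ f y := by
  have hd := hp.hasDerivWithinAt_segment hf.1 hx hy
  have hmaps : ∀ r ∈ Set.Icc (0 : ℝ) 1, x + r • (y - x) ∈ W :=
    fun r hr => hf.1.add_smul_sub_mem hx hy hr
  have hconv : ConvexOn ℝ (Set.Icc (0 : ℝ) 1) fun r : ℝ => f (x + r • (y - x)) := by
    refine ⟨convex_Icc 0 1, fun a ha b hb u v hu hv huv => ?_⟩
    have := hf.2 (hmaps a ha) (hmaps b hb) hu hv huv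
    refine le_trans (le_of_eq (congrArg f ?_)) this
    calc x + (u • a + v • b) • (y - x)
        = (1 : ℝ) • x + (u • a + v • b) • (y - x) := by rw [one_smul]
      _ = u • (x + a • (y - x)) + v • (x + b • (y - x)) := by
        rw [← huv]
        simp only [smul_eq_mul]
        module
  have hd' : HasDerivWithinAt (fun r : ℝ => f (x + r • (y - x))) (inner ℝ p (y - x))
      (Set.Ioi 0) 0 :=
    hd.mono_of_mem_nhdsWithin (Icc_mem_nhdsGT one_pos)
  have := hconv.le_slope_of_hasDerivWithinAt_Ioi (by simp) (by simp) one_pos hd'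
  simp [slope_def_field] at this
  linarith

/-- Limit of difference quotients along the segment. Only feasible directions are controlled: `‖p‖ ≤
G` may fail, because a gradient within a set without interior is not determined transversally to it.
-/
theorem HasGradientWithinAt.abs_inner_le_of_lipschitz {p x y : E} {G : ℝ}
    (hp : HasGradientWithinAt f p W x) (hW : Convex ℝ W)
    (hG : ∀ x ∈ W, ∀ y ∈ W, |f x - f y| ≤ G * ‖x - y‖) (hx : x ∈ W) (hy : y ∈ W) :
    |inner ℝ p (y - x)| ≤ G * ‖y - x‖ := by
  have hd' : HasDerivWithinAt (fun r : ℝ => f (x + r • (y - x))) (inner ℝ p (y - x))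
      (Set.Ioi 0) 0 :=
    (hp.hasDerivWithinAt_segment hW hx hy).mono_of_mem_nhdsWithin (Icc_mem_nhdsGT one_pos)
  have ht := (hasDerivWithinAt_iff_tendsto_slope' (by simp)).1 hd'
  refine le_of_tendsto ht.abs ?_
  filter_upwards [Icc_mem_nhdsGT (one_pos : (0 : ℝ) < 1), self_mem_nhdsWithin] with r hr hr0
  have hr0' : 0 < r := hr0
  have := hG _ (hW.add_smul_sub_mem hx hy hr) x hx
  simp only [slope_def_field, zero_smul, add_zero, sub_zero, abs_div, abs_of_pos hr0']
  rw [div_le_iff₀ hr0']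
  refine this.trans (le_of_eq ?_)
  rw [add_sub_cancel_left, norm_smul, Real.norm_of_nonneg hr0'.le]
  ring

end Convexity

/-! ### Functions with Lipschitz gradient. -/

section Smooth

variable {E : Type*} [NormedAddCommGroup E] [InnerProductSpace ℝ E] [CompleteSpace E]
  {f : E → ℝ} {f' : E → E} {β : ℝ}

/-- Along the segment, `f` minus its claimed quadratic majorant has nonpositive derivative by
Cauchy–Schwarz, so no integral of the gradient is needed. -/
theorem le_quadratic_of_lipschitz_gradient (hf : ∀ x, HasGradientAt f (f' x) x)
    (hβ : ∀ x y, ‖f' x - f' y‖ ≤ β * ‖x - y‖) (x y : E) :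
    f y ≤ f x + inner ℝ (f' x) (y - x) + β / 2 * ‖y - x‖ ^ 2 := by
  set φ : ℝ → ℝ := fun r => f (x + r • (y - x)) - r * inner ℝ (f' x) (y - x)
    - r ^ 2 * (β / 2 * ‖y - x‖ ^ 2) with hφ
  have hline : ∀ r : ℝ, HasDerivAt (fun r : ℝ => x + r • (y - x)) (y - x) r := fun r => by
    simpa using ((hasDerivAt_id r).smul_const (y - x)).const_add x
  have hder : ∀ r : ℝ, HasDerivAt φ (inner ℝ (f' (x + r • (y - x))) (y - x)
      - inner ℝ (f' x) (y - x) - 2 * r * (β / 2 * ‖y - x‖ ^ 2)) r := fun r => by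
    have h₁ := (hf (x + r • (y - x))).hasFDerivAt.comp_hasDerivAt r (hline r)
    have h₂ := (hasDerivAt_id r).mul_const (inner ℝ (f' x) (y - x))
    have h₃ := (hasDerivAt_pow 2 r).mul_const (β / 2 * ‖y - x‖ ^ 2)
    refine HasDerivAt.congr_deriv (f := φ) ((h₁.sub h₂).sub h₃) ?_
    simp
  have hanti : AntitoneOn φ (Set.Icc 0 1) := by
    refine antitoneOn_of_deriv_nonpos (convex_Icc 0 1)
      (fun r _ => (hder r).continuousAt.continuousWithinAt)
      (fun r _ => (hder r).differentiableAt.differentiableWithinAt) fun r hr => ?_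
    rw [interior_Icc] at hr
    rw [(hder r).deriv, ← inner_sub_left]
    have h₁ := real_inner_le_norm (f' (x + r • (y - x)) - f' x) (y - x)
    have h₂ := hβ (x + r • (y - x)) x
    rw [add_sub_cancel_left, norm_smul, Real.norm_of_nonneg hr.1.le] at h₂
    have h₃ := mul_le_mul_of_nonneg_right h₂ (norm_nonneg (y - x))
    nlinarith
  have := hanti (by simp : (0 : ℝ) ∈ Set.Icc (0 : ℝ) 1) (by simp : (1 : ℝ) ∈ Set.Icc (0 : ℝ) 1)
    zero_le_one
  simp [hφ] at this
  linarith

/-- One gradient step of length `1 / β` lowers `f` by at least `‖f' x‖² / (2β)`, and `f` cannot fall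
below `c`. It covers the cases where the output is `w₁`. -/
theorem norm_gradient_sq_le_of_lipschitz_gradient (hf : ∀ x, HasGradientAt f (f' x) x)
    (hβ0 : 0 < β) (hβ : ∀ x y, ‖f' x - f' y‖ ≤ β * ‖x - y‖) {c : ℝ} (hc : ∀ x, c ≤ f x) (x : E) :
    ‖f' x‖ ^ 2 ≤ 2 * β * (f x - c) := by
  have h := (hc _).trans (le_quadratic_of_lipschitz_gradient hf hβ x (x - (1 / β) • f' x))
  rw [sub_sub_cancel_left, norm_neg, inner_neg_right, inner_smul_right, norm_smul, mul_pow,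
    real_inner_self_eq_norm_sq, Real.norm_of_nonneg (by positivity)] at h
  have e : β / 2 * ((1 / β) ^ 2 * ‖f' x‖ ^ 2) = 1 / β * ‖f' x‖ ^ 2 / 2 := by field_simp
  rw [e] at h
  have h' : 1 / β * ‖f' x‖ ^ 2 ≤ 2 * (f x - c) := by linarith
  rw [one_div, inv_mul_le_iff₀ hβ0] at h'
  linarith

theorem gradient_eq_zero_of_forall_le (hf : ∀ x, HasGradientAt f (f' x) x) {x : E}
    (hx : ∀ y, f x ≤ f y) : f' x = 0 := by
  have hmin : IsLocalMin f x := Filter.Eventually.of_forall hx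
  have h := hmin.hasFDerivAt_eq_zero (hf x).hasFDerivAt
  simpa using h

theorem le_quadratic_of_forall_le (hf : ∀ x, HasGradientAt f (f' x) x)
    (hβ : ∀ x y, ‖f' x - f' y‖ ≤ β * ‖x - y‖) {x : E} (hx : ∀ y, f x ≤ f y) (y : E) :
    f y - f x ≤ β / 2 * ‖y - x‖ ^ 2 := by
  have h := le_quadratic_of_lipschitz_gradient hf hβ x y
  rw [gradient_eq_zero_of_forall_le hf hx, inner_zero_left] at h
  linarith

/-- Compare two bounds at the point `m + f' x / β`: the quadratic majorant around `m` and the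
tangent at `x`. The extra gradient term is what later absorbs `γ² ‖∇f‖²` in SGD for all `γ ≤ 1 / β`.
-/
theorem ConvexOn.add_norm_gradient_sq_le (hconv : ConvexOn ℝ Set.univ f)
    (hf : ∀ x, HasGradientAt f (f' x) x) (hβ0 : 0 < β)
    (hβ : ∀ x y, ‖f' x - f' y‖ ≤ β * ‖x - y‖) {m : E} (hm : ∀ y, f m ≤ f y) (x : E) :
    f x - f m + 1 / (2 * β) * ‖f' x‖ ^ 2 ≤ inner ℝ (f' x) (x - m) := by
  have h₁ := le_quadratic_of_forall_le hf hβ hm (m + (1 / β) • f' x)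
  have h₂ := hconv.add_inner_le (hasGradientWithinAt_univ.2 (hf x)) (Set.mem_univ x)
    (Set.mem_univ (m + (1 / β) • f' x))
  have e₁ : m + (1 / β) • f' x - x = (1 / β) • f' x - (x - m) := by abel
  rw [add_sub_cancel_left, norm_smul, mul_pow, Real.norm_of_nonneg (by positivity)] at h₁
  rw [e₁, inner_sub_right, inner_smul_right, real_inner_self_eq_norm_sq] at h₂
  have e₂ : β / 2 * ((1 / β) ^ 2 * ‖f' x‖ ^ 2) = 1 / (2 * β) * ‖f' x‖ ^ 2 := by field_simp
  have e₃ : 1 / β * ‖f' x‖ ^ 2 = 2 * (1 / (2 * β) * ‖f' x‖ ^ 2) := by field_simp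
  rw [e₂] at h₁
  rw [e₃] at h₂
  linarith

end Smooth

/-! ### Euclidean projection. -/

section Projection

variable {E : Type*} [NormedAddCommGroup E] [InnerProductSpace ℝ E] [CompleteSpace E]
  {W : Set E}

theorem nearestPoint_spec (hW : IsClosed W) (hconv : Convex ℝ W) (hne : W.Nonempty) (x : E) :
    nearestPoint W x ∈ W ∧ ∀ z ∈ W, ‖x - nearestPoint W x‖ ≤ ‖x - z‖ := by
  refine Classical.epsilon_spec (p := fun y => y ∈ W ∧ ∀ z ∈ W, ‖x - y‖ ≤ ‖x - z‖) ?_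
  obtain ⟨v, hv, h⟩ := exists_norm_eq_iInf_of_complete_convex hne hW.isComplete hconv x
  refine ⟨v, hv, fun z hz => h ▸ ?_⟩
  exact ciInf_le ⟨0, by rintro _ ⟨w, rfl⟩; exact norm_nonneg _⟩ (⟨z, hz⟩ : W)

theorem inner_sub_nearestPoint_nonpos (hW : IsClosed W) (hconv : Convex ℝ W) (x : E) {z : E}
    (hz : z ∈ W) : inner ℝ (x - nearestPoint W x) (z - nearestPoint W x) ≤ 0 := by
  obtain ⟨h₁, h₂⟩ := nearestPoint_spec hW hconv ⟨z, hz⟩ x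
  refine (norm_eq_iInf_iff_real_inner_le_zero hconv h₁).1 ?_ z hz
  have : Nonempty W := ⟨⟨z, hz⟩⟩
  exact le_antisymm (le_ciInf fun w => h₂ w w.2)
    (ciInf_le ⟨0, by rintro _ ⟨w, rfl⟩; exact norm_nonneg _⟩ (⟨_, h₁⟩ : W))

/-- Add the variational inequalities at the two projections and apply Cauchy–Schwarz.
Nonexpansiveness serves to make the projected iterates measurable. -/
theorem lipschitzWith_nearestPoint (hW : IsClosed W) (hconv : Convex ℝ W) (hne : W.Nonempty) :
    LipschitzWith 1 (nearestPoint W) := by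
  refine LipschitzWith.of_dist_le_mul fun x y => ?_
  rw [NNReal.coe_one, one_mul, dist_eq_norm, dist_eq_norm]
  have h₁ := inner_sub_nearestPoint_nonpos hW hconv x (nearestPoint_spec hW hconv hne y).1
  have h₂ := inner_sub_nearestPoint_nonpos hW hconv y (nearestPoint_spec hW hconv hne x).1
  set p := nearestPoint W x
  set r := nearestPoint W y
  have h₃ : ‖p - r‖ ^ 2 ≤ inner ℝ (x - y) (p - r) := by
    have e₁ : inner ℝ (x - p) (r - p) = -inner ℝ (x - p) (p - r) := by
      rw [← inner_neg_right, neg_sub]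
    have e₂ : inner ℝ (x - y) (p - r) =
        inner ℝ (x - p) (p - r) - inner ℝ (y - r) (p - r) + ‖p - r‖ ^ 2 := by
      rw [← real_inner_self_eq_norm_sq, ← inner_sub_left, ← inner_add_left]
      congr 1
      abel
    linarith
  have h₄ := real_inner_le_norm (x - y) (p - r)
  by_contra! hlt
  have := norm_nonneg (x - y)
  nlinarith

end Projection

/-! ### Tuning of the step size. -/

section StepSize

/-- Divide by `γ`: `b γ ≤ √(a b)` because `γ ≤ √(a / b)`, and `a / γ` is `a β` or `√(a b)` according
to which term is the minimum. The condition `hab` rules out `a = 0 < b`, where `γ = 0` and nothing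
follows. -/
theorem le_of_step_mul_le {β a b γ X : ℝ} (hβ : 0 < β) (hb : 0 ≤ b)
    (hab : b = 0 ∨ 0 < a) (hγ : γ = if b = 0 then 1 / β else min (1 / β) √(a / b))
    (h : γ * X ≤ a + b * γ ^ 2) : X ≤ a * β + 2 * √(a * b) := by
  rcases hb.eq_or_lt with rfl | hb
  · rw [if_pos rfl] at hγ
    rw [hγ, one_div, inv_mul_le_iff₀ hβ] at h
    have := Real.sqrt_nonneg (a * 0)
    linarith
  have ha : 0 < a := hab.resolve_left hb.ne'
  rw [if_neg hb.ne'] at hγ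
  have hsq : √(a / b) * b = √(a * b) := by
    rw [eq_comm, Real.sqrt_eq_iff_mul_self_eq (by positivity) (by positivity)]
    have := Real.mul_self_sqrt (by positivity : 0 ≤ a / b)
    calc a * b = (√(a / b) * √(a / b)) * b * b := by rw [this]; field_simp
      _ = √(a / b) * b * (√(a / b) * b) := by ring
  have hγ0 : 0 < γ := by rw [hγ]; positivity
  have hle : γ ≤ √(a / b) := hγ ▸ min_le_right _ _
  have h₁ : b * γ ≤ √(a * b) := by
    rw [← hsq]
    nlinarith
  have h₂ : a / γ ≤ a * β + √(a * b) := by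
    rcases min_choice (1 / β) √(a / b) with hm | hm
    · rw [hγ, hm, div_div_eq_mul_div, div_one]
      have := Real.sqrt_nonneg (a * b)
      linarith
    · have e : a / γ = √(a * b) := by
        rw [hγ, hm, ← hsq, div_eq_iff (by positivity)]
        have := Real.mul_self_sqrt (by positivity : 0 ≤ a / b)
        calc a = (√(a / b) * √(a / b)) * b := by rw [this]; field_simp
          _ = _ := by ring
      rw [e]
      have : 0 < a * β := by positivity
      linarith
  have h₃ : X ≤ a / γ + b * γ := by
    rw [div_add' _ _ _ hγ0.ne', le_div_iff₀ hγ0]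
    nlinarith
  linarith

end StepSize

theorem sum_le_of_forall_add_le {a c e : ℕ → ℝ} {K : ℕ}
    (h : ∀ k < K, a (k + 1) + c k ≤ a k + e k) :
    ∑ k ∈ Finset.range K, c k ≤ a 0 - a K + ∑ k ∈ Finset.range K, e k := by
  induction K with
  | zero => simp
  | succ K ih =>
    rw [Finset.sum_range_succ, Finset.sum_range_succ]
    have h₁ := ih fun k hk => h k (by omega)
    have h₂ := h K (by omega)
    linarith

/-! ### Integrability along square-integrable iterates. -/

section SquareIntegrable

variable {E Z : Type*} [NormedAddCommGroup E] [InnerProductSpace ℝ E] [CompleteSpace E]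
  [MeasurableSpace E] [BorelSpace E] [SecondCountableTopology E] [MeasurableSpace Z]
  {ν : Measure Z} [IsProbabilityMeasure ν] {f : E → ℝ} {f' : E → E} {β : ℝ}

theorem continuous_of_norm_sub_le (hβ : ∀ x y, ‖f' x - f' y‖ ≤ β * ‖x - y‖) : Continuous f' := by
  refine (LipschitzWith.of_dist_le' (K := β) fun x y => ?_).continuous
  simpa [dist_eq_norm] using hβ x y

theorem memLp_two_comp_of_lipschitz (hβ : ∀ x y, ‖f' x - f' y‖ ≤ β * ‖x - y‖) {X : Z → E}
    (hX : MemLp X 2 ν) : MemLp (fun z => f' (X z)) 2 ν := by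
  have hbound : MemLp (fun z => ‖f' 0‖ + β * ‖X z‖) 2 ν :=
    (memLp_const ‖f' 0‖).add (hX.norm.const_mul β)
  refine hbound.mono' ((continuous_of_norm_sub_le hβ).comp_aestronglyMeasurable hX.1) (ae_of_all _ fun z => ?_)
  have h₁ := hβ (X z) 0
  have h₂ := norm_sub_norm_le (f' (X z)) (f' 0)
  rw [sub_zero] at h₁
  linarith

/-- `f` lies between the constant `c` and a quadratic function. -/
theorem integrable_comp_of_lipschitz_gradient (hf : ∀ x, HasGradientAt f (f' x) x)
    (hβ : ∀ x y, ‖f' x - f' y‖ ≤ β * ‖x - y‖) {c : ℝ} (hc : ∀ x, c ≤ f x) {X : Z → E}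
    (hX : MemLp X 2 ν) : Integrable (fun z => f (X z)) ν := by
  have hcont : Continuous f := continuous_iff_continuousAt.2 fun x => (hf x).continuousAt
  have hX1 : Integrable (fun z => ‖X z‖) ν := (hX.integrable one_le_two).norm
  have hX2 : Integrable (fun z => ‖X z‖ ^ 2) ν := hX.integrable_norm_pow two_ne_zero
  refine Integrable.mono'
    (g := fun z => |c| + |f 0| + ‖f' 0‖ * ‖X z‖ + β / 2 * ‖X z‖ ^ 2)
    (((integrable_const _).add (hX1.const_mul _)).add (hX2.const_mul _))
    (hcont.comp_aestronglyMeasurable hX.1) (ae_of_all _ fun z => ?_)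
  have h₁ := le_quadratic_of_lipschitz_gradient hf hβ 0 (X z)
  have h₂ := real_inner_le_norm (f' 0) (X z)
  have h₃ := hc (X z)
  have h₄ := neg_abs_le c
  have h₅ := le_abs_self (f 0)
  have h₆ := abs_nonneg (f 0)
  have h₇ := abs_nonneg c
  rw [sub_zero] at h₁
  rw [Real.norm_eq_abs, abs_le]
  have h₈ : 0 ≤ ‖f' 0‖ * ‖X z‖ := by positivity
  have h₉ : 0 ≤ β * ‖X z‖ ^ 2 := by
    have h := hβ (X z) 0
    rw [sub_zero] at h
    have := mul_nonneg ((norm_nonneg _).trans h) (norm_nonneg (X z))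
    calc 0 ≤ β * ‖X z‖ * ‖X z‖ := this
      _ = _ := by ring
  constructor <;> linarith

end SquareIntegrable

/-! ### SGD. -/

section SGD

variable {E Z : Type*} [NormedAddCommGroup E] [InnerProductSpace ℝ E] [CompleteSpace E]
  [MeasurableSpace E] [BorelSpace E] [SecondCountableTopology E] [MeasurableSpace Z]
  {ν : Measure Z} [IsProbabilityMeasure ν] {f : E → ℝ} {f' : E → E} {β γ s : ℝ} {w₁ : E}
  {K r : ℕ} {V : ℕ → Z → E}

theorem sgdIterate_history_succ (γ : ℝ) (w₁ : E) (V : ℕ → Z → E) (k : ℕ) (z : Z) :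
    sgdIterate γ w₁ (history V (k + 1) z) = sgdIterate γ w₁ (history V k z) - γ • V k z := by
  simp [history_succ, sgdIterate]

theorem sgdIterate_zero_step (w₁ : E) (l : List E) : sgdIterate 0 w₁ l = w₁ := by
  simp only [sgdIterate, zero_smul, sub_zero]
  induction l with
  | nil => rfl
  | cons a l ih => simp

theorem measurable_sgdIterate_history (γ : ℝ) (w₁ : E) {V : ℕ → Z → E} (k : ℕ)
    (hV : ∀ j < k, Measurable (V j)) : Measurable fun z => sgdIterate γ w₁ (history V k z) := by
  induction k with
  | zero => exact measurable_const
  | succ k ih =>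
    simp_rw [sgdIterate_history_succ]
    exact (ih fun j hj => hV j (by omega)).sub ((hV k (by omega)).const_smul γ)

theorem IsStochasticResponses.memLp_response {A : FirstOrderAlgorithm E}
    (h : IsStochasticResponses ν A f' s K V) (hβ : ∀ x y, ‖f' x - f' y‖ ≤ β * ‖x - y‖)
    {k : ℕ} (hk : k < K) (hX : MemLp (fun z => A.query (history V k z)) 2 ν) :
    MemLp (V k) 2 ν := by
  have := (h.memLp k hk).add (memLp_two_comp_of_lipschitz hβ hX)
  refine this.ae_eq (ae_of_all _ fun z => ?_)
  simp

/-- The passage from a pointwise one-step inequality to expectations, shared by all algorithms: the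
noise term linear in a function of the history vanishes and the quadratic one costs `b s²`. -/
theorem IsStochasticResponses.integral_step {A : FirstOrderAlgorithm E}
    (h : IsStochasticResponses ν A f' s K V) {k : ℕ} (hk : k < K) {Φ Ψ Φ' : Z → ℝ}
    (hΦ : Integrable Φ ν) (hΨ : Integrable Ψ ν) (hΦ' : Integrable Φ' ν) {φ : List E → E}
    (hφ : MemLp (fun z => φ (history V k z)) 2 ν) {a b c : ℝ} (hb : 0 ≤ b)
    (hpt : ∀ z, Φ' z + a * Ψ z ≤ Φ z +
      inner ℝ (V k z - f' (A.query (history V k z))) (φ (history V k z)) +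
      b * ‖V k z - f' (A.query (history V k z))‖ ^ 2 + c) :
    ∫ z, Φ' z ∂ν + a * ∫ z, Ψ z ∂ν ≤ ∫ z, Φ z ∂ν + (b * s ^ 2 + c) := by
  have hin := integrable_inner_of_memLp_two (h.memLp k hk) hφ
  have hsq := (h.memLp k hk).integrable_norm_pow two_ne_zero
  have hmono := integral_mono (hΦ'.add (hΨ.const_mul a))
    (((hΦ.add hin).add (hsq.const_mul b)).add (integrable_const c)) hpt
  rw [integral_add' hΦ' (hΨ.const_mul a),
    integral_add' ((hΦ.add hin).add (hsq.const_mul b)) (integrable_const c),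
    integral_add' (hΦ.add hin) (hsq.const_mul b), integral_add' hΦ hin, integral_const_mul,
    integral_const_mul, h.unbiased k hk φ hφ] at hmono
  have := mul_le_mul_of_nonneg_left (h.variance k hk) hb
  simp only [integral_const, probReal_univ, one_smul] at hmono
  linarith

theorem IsStochasticResponses.memLp_sgdIterate (h : IsStochasticResponses ν (sgd γ w₁ r) f' s K V)
    (hβ : ∀ x y, ‖f' x - f' y‖ ≤ β * ‖x - y‖) {k : ℕ} (hk : k ≤ K) :
    MemLp (fun z => sgdIterate γ w₁ (history V k z)) 2 ν := by
  induction k with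
  | zero => exact memLp_const _
  | succ k ih =>
    simp_rw [sgdIterate_history_succ]
    have hX := ih (by omega)
    exact hX.sub ((h.memLp_response hβ hk hX).const_smul γ)

/-- The potential is `f`. In the quadratic upper bound the coefficient of `‖f'‖²` is `-γ + βγ²/2 ≤
-γ/2`, and the noise meets `(βγ² - γ) f'`, a function of the history. -/
theorem IsStochasticResponses.sgd_nonconvex (h : IsStochasticResponses ν (sgd γ w₁ r) f' s K V)
    (hf : ∀ x, HasGradientAt f (f' x) x) (hβ0 : 0 < β)
    (hβ : ∀ x y, ‖f' x - f' y‖ ≤ β * ‖x - y‖) {c : ℝ} (hc : ∀ x, c ≤ f x)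
    (hγ0 : 0 ≤ γ) (hγ : γ ≤ 1 / β) :
    γ * ∑ k ∈ Finset.range K, ∫ z, ‖f' (sgdIterate γ w₁ (history V k z))‖ ^ 2 ∂ν ≤
      2 * (f w₁ - c) + K * (β * s ^ 2 * γ ^ 2) := by
  have hβγ : β * γ ≤ 1 := by
    rw [le_div_iff₀ hβ0] at hγ
    linarith
  set X : ℕ → Z → E := fun k z => sgdIterate γ w₁ (history V k z) with hX
  have hXL : ∀ k ≤ K, MemLp (X k) 2 ν := fun k hk => h.memLp_sgdIterate hβ hk
  have hstep : ∀ k < K, ∫ z, f (X (k + 1) z) ∂ν + γ / 2 * ∫ z, ‖f' (X k z)‖ ^ 2 ∂ν ≤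
      ∫ z, f (X k z) ∂ν + β * γ ^ 2 / 2 * s ^ 2 := by
    intro k hk
    have hgL := memLp_two_comp_of_lipschitz hβ (hXL k hk.le)
    have hpt : ∀ z, f (X (k + 1) z) + γ / 2 * ‖f' (X k z)‖ ^ 2 ≤
        f (X k z) + inner ℝ (V k z - f' (X k z)) ((β * γ ^ 2 - γ) • f' (X k z)) +
          β * γ ^ 2 / 2 * ‖V k z - f' (X k z)‖ ^ 2 + 0 := by
      intro z
      have h₁ := le_quadratic_of_lipschitz_gradient hf hβ (X k z) (X (k + 1) z)
      have e₁ : X (k + 1) z - X k z = -(γ • ((V k z - f' (X k z)) + f' (X k z))) := by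
        simp [hX, sgdIterate_history_succ]
      rw [e₁, norm_neg, norm_smul, mul_pow, norm_add_sq_real, inner_neg_right, inner_smul_right,
        inner_add_right, real_inner_self_eq_norm_sq, Real.norm_of_nonneg hγ0,
        real_inner_comm] at h₁
      rw [inner_smul_right]
      have h₂ : 0 ≤ γ * (1 - β * γ) * ‖f' (X k z)‖ ^ 2 :=
        mul_nonneg (mul_nonneg hγ0 (by linarith)) (by positivity)
      nlinarith
    have hi₀ := integrable_comp_of_lipschitz_gradient hf hβ hc (hXL k hk.le)
    have hi₁ := integrable_comp_of_lipschitz_gradient hf hβ hc (hXL (k + 1) hk)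
    have hi₂ : Integrable (fun z => ‖f' (X k z)‖ ^ 2) ν := hgL.integrable_norm_pow two_ne_zero
    have := h.integral_step hk hi₀ hi₂ hi₁
      (φ := fun l => (β * γ ^ 2 - γ) • f' (sgdIterate γ w₁ l)) (hgL.const_smul _)
      (by positivity) hpt
    simpa using this
  have hsum := sum_le_of_forall_add_le (a := fun k => ∫ z, f (X k z) ∂ν)
    (c := fun k => γ / 2 * ∫ z, ‖f' (X k z)‖ ^ 2 ∂ν) (e := fun _ => β * γ ^ 2 / 2 * s ^ 2) hstep
  rw [← Finset.mul_sum, Finset.sum_const, Finset.card_range, nsmul_eq_mul] at hsum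
  have h₀ : ∫ z, f (X 0 z) ∂ν = f w₁ := by simp [hX, history_zero, sgdIterate]
  have hK : c ≤ ∫ z, f (X K z) ∂ν := by
    have := integral_mono (integrable_const c)
      (integrable_comp_of_lipschitz_gradient hf hβ hc (hXL K le_rfl)) fun z => hc _
    simpa using this
  rw [h₀] at hsum
  have : K * (β * γ ^ 2 / 2 * s ^ 2) = K * (β * s ^ 2 * γ ^ 2) / 2 := by ring
  linarith

/-- The potential is `‖w_k - m‖²`. Its term `γ² ‖f'‖²` is paid by the gradient term of
`ConvexOn.add_norm_gradient_sq_le`, so the gap keeps the full factor `2γ`. -/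
theorem IsStochasticResponses.sgd_convex (h : IsStochasticResponses ν (sgd γ w₁ r) f' s K V)
    (hf : ∀ x, HasGradientAt f (f' x) x) (hβ0 : 0 < β)
    (hβ : ∀ x y, ‖f' x - f' y‖ ≤ β * ‖x - y‖) (hconv : ConvexOn ℝ Set.univ f)
    {m : E} (hm : ∀ x, f m ≤ f x) (hγ0 : 0 ≤ γ) (hγ : γ ≤ 1 / β) :
    2 * γ * ∑ k ∈ Finset.range K, ∫ z, (f (sgdIterate γ w₁ (history V k z)) - f m) ∂ν ≤
      ‖w₁ - m‖ ^ 2 + K * (s ^ 2 * γ ^ 2) := by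
  have hβγ : γ ≤ 2 * (1 / (2 * β)) := by
    refine hγ.trans (le_of_eq ?_)
    field_simp
  set X : ℕ → Z → E := fun k z => sgdIterate γ w₁ (history V k z) with hX
  have hXL : ∀ k ≤ K, MemLp (X k) 2 ν := fun k hk => h.memLp_sgdIterate hβ hk
  have hXm : ∀ k ≤ K, MemLp (fun z => X k z - m) 2 ν := fun k hk =>
    (hXL k hk).sub (memLp_const m)
  have hstep : ∀ k < K, ∫ z, ‖X (k + 1) z - m‖ ^ 2 ∂ν + 2 * γ * ∫ z, (f (X k z) - f m) ∂ν ≤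
      ∫ z, ‖X k z - m‖ ^ 2 ∂ν + s ^ 2 * γ ^ 2 := by
    intro k hk
    have hgL := memLp_two_comp_of_lipschitz hβ (hXL k hk.le)
    have hYL : MemLp (fun z => (2 * γ ^ 2) • f' (X k z) - (2 * γ) • (X k z - m)) 2 ν :=
      (hgL.const_smul _).sub ((hXm k hk.le).const_smul _)
    have hpt : ∀ z, ‖X (k + 1) z - m‖ ^ 2 + 2 * γ * (f (X k z) - f m) ≤
        ‖X k z - m‖ ^ 2 + inner ℝ (V k z - f' (X k z))
          ((2 * γ ^ 2) • f' (X k z) - (2 * γ) • (X k z - m)) +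
          γ ^ 2 * ‖V k z - f' (X k z)‖ ^ 2 + 0 := by
      intro z
      have h₁ := hconv.add_norm_gradient_sq_le hf hβ0 hβ hm (X k z)
      have e₁ : X (k + 1) z - m = (X k z - m) - γ • ((V k z - f' (X k z)) + f' (X k z)) := by
        simp only [hX, sgdIterate_history_succ]
        module
      rw [e₁]
      generalize V k z - f' (X k z) = δ
      generalize X k z - m = y at h₁ ⊢
      rw [norm_sub_sq_real, norm_smul, mul_pow, norm_add_sq_real, inner_smul_right,
        inner_add_right, Real.norm_of_nonneg hγ0, inner_sub_right, inner_smul_right,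
        inner_smul_right, real_inner_comm δ y, real_inner_comm (f' (X k z)) y]
      have h₂ := mul_le_mul_of_nonneg_left h₁ (by linarith : 0 ≤ 2 * γ)
      have h₃ : γ * γ * ‖f' (X k z)‖ ^ 2 ≤ γ * (2 * (1 / (2 * β))) * ‖f' (X k z)‖ ^ 2 :=
        mul_le_mul_of_nonneg_right (mul_le_mul_of_nonneg_left hβγ hγ0) (by positivity)
      nlinarith
    have hi₀ : Integrable (fun z => ‖X k z - m‖ ^ 2) ν :=
      (hXm k hk.le).integrable_norm_pow two_ne_zero
    have hi₁ : Integrable (fun z => ‖X (k + 1) z - m‖ ^ 2) ν :=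
      (hXm (k + 1) hk).integrable_norm_pow two_ne_zero
    have hi₂ : Integrable (fun z => f (X k z) - f m) ν :=
      (integrable_comp_of_lipschitz_gradient hf hβ hm (hXL k hk.le)).sub (integrable_const _)
    have := h.integral_step hk hi₀ hi₂ hi₁
      (φ := fun l => (2 * γ ^ 2) • f' (sgdIterate γ w₁ l) - (2 * γ) • (sgdIterate γ w₁ l - m))
      hYL (by positivity) hpt
    linarith
  have hsum := sum_le_of_forall_add_le (a := fun k => ∫ z, ‖X k z - m‖ ^ 2 ∂ν)
    (c := fun k => 2 * γ * ∫ z, (f (X k z) - f m) ∂ν) (e := fun _ => s ^ 2 * γ ^ 2) hstep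
  rw [← Finset.mul_sum, Finset.sum_const, Finset.card_range, nsmul_eq_mul] at hsum
  have h₀ : ∫ z, ‖X 0 z - m‖ ^ 2 ∂ν = ‖w₁ - m‖ ^ 2 := by simp [hX, history_zero, sgdIterate]
  have hK : 0 ≤ ∫ z, ‖X K z - m‖ ^ 2 ∂ν := integral_nonneg fun z => by positivity
  rw [h₀] at hsum
  linarith

end SGD

/-! ### Accelerated SGD. -/

section AcceleratedSGD

variable {E Z : Type*} [NormedAddCommGroup E] [InnerProductSpace ℝ E] [CompleteSpace E]
  [MeasurableSpace E] [BorelSpace E] [SecondCountableTopology E] [MeasurableSpace Z]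
  {ν : Measure Z} [IsProbabilityMeasure ν] {f : E → ℝ} {f' : E → E} {β γ s : ℝ} {w₁ : E}
  {K : ℕ} {V : ℕ → Z → E}

/-- Here `c` is the number of the step. As `α (c + 1) = 2`, the weight `(c + 1) c` satisfies `(1 -
α)(c + 1) c = c (c - 1)`, the previous weight, and `α (c + 1) c = 2c`. Hence the term in `⟪v, x -
m⟫` of the weighted smoothness bound cancels that of `‖x' - m‖²`, and the linear noise meets `x -
m`, which is known before `v`. -/
theorem acsa_step (hf : ∀ x, HasGradientAt f (f' x) x) (hβ0 : 0 < β)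
    (hβ : ∀ x y, ‖f' x - f' y‖ ≤ β * ‖x - y‖) (hconv : ConvexOn ℝ Set.univ f)
    (hγ0 : 0 ≤ γ) (hγ : γ ≤ 1 / (4 * β)) {c α : ℝ} (hc : 1 ≤ c) (hα : α = 2 / (c + 1))
    {x u y x' u' v : E} (m : E) (hy : y = (1 - α) • u + α • x) (hx' : x' = x - (γ * c) • v)
    (hu' : u' = (1 - α) • u + α • x') :
    ‖x' - m‖ ^ 2 + γ * ((c + 1) * c) * (f u' - f m) ≤
      ‖x - m‖ ^ 2 + γ * (c * (c - 1)) * (f u - f m) +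
        inner ℝ (v - f' y) (-(2 * γ * c) • (x - m)) + 2 * γ ^ 2 * c ^ 2 * ‖v - f' y‖ ^ 2 := by
  have hβγ : β * γ ≤ 1 / 4 := by
    rw [le_div_iff₀ (by positivity)] at hγ
    linarith
  have h₁ := le_quadratic_of_lipschitz_gradient hf hβ y u'
  have h₂ := hconv.add_inner_le (hasGradientWithinAt_univ.2 (hf y)) (Set.mem_univ y)
    (Set.mem_univ u)
  have h₃ := hconv.add_inner_le (hasGradientWithinAt_univ.2 (hf y)) (Set.mem_univ y)
    (Set.mem_univ m)
  have e₁ : u' - y = -((α * (γ * c)) • v) := by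
    rw [hu', hy, hx']
    module
  -- The form of `u' - y` suited to convexity: tangents at `y` are compared with `u` and with `m`,
  -- in proportions `1 - α` and `α`.
  have e₂ : u' - y = (1 - α) • (u - y) + α • ((m - y) + ((x - m) - (γ * c) • v)) := by
    rw [hu', hx']
    module
  have e₃ : ‖u' - y‖ ^ 2 = (α * (γ * c)) ^ 2 * ‖v‖ ^ 2 := by
    rw [e₁, norm_neg, norm_smul, mul_pow, Real.norm_eq_abs, sq_abs]
  rw [e₃, e₂, inner_add_right, inner_smul_right, inner_smul_right, inner_add_right,
    inner_sub_right _ (x - m), inner_smul_right] at h₁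
  have e₄ : ‖x' - m‖ ^ 2 = ‖x - m‖ ^ 2 - 2 * (γ * c) * inner ℝ v (x - m) +
      (γ * c) ^ 2 * ‖v‖ ^ 2 := by
    have : x' - m = (x - m) - (γ * c) • v := by
      rw [hx']
      module
    rw [this, norm_sub_sq_real, inner_smul_right, norm_smul, mul_pow, Real.norm_eq_abs, sq_abs,
      real_inner_comm v]
    ring
  have e₅ : inner ℝ (f' y) (x - m) = inner ℝ v (x - m) - inner ℝ (v - f' y) (x - m) := by
    rw [← inner_sub_left]
    congr 1
    abel
  have e₆ : inner ℝ (f' y) v = ‖v‖ ^ 2 - inner ℝ (v - f' y) v := by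
    rw [← real_inner_self_eq_norm_sq, ← inner_sub_left]
    congr 1
    abel
  -- The coefficients of `γ² c² ‖v‖²` are `1` from `e₄`, `-2` from `e₆`, `1/2` from this inequality
  -- and `1/2` from `h₇`, where `γ ≤ 1 / (4β)` enters. They cancel exactly.
  have h₄ : inner ℝ (v - f' y) v ≤ ‖v - f' y‖ ^ 2 + ‖v‖ ^ 2 / 4 := by
    have := real_inner_le_norm (v - f' y) v
    nlinarith [sq_nonneg (‖v - f' y‖ - ‖v‖ / 2)]
  rw [e₅, e₆] at h₁
  rw [e₄, inner_smul_right]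
  have hα0 : 0 ≤ α := by rw [hα]; positivity
  have hα1 : 0 ≤ 1 - α := by
    rw [hα, sub_nonneg, div_le_one (by positivity)]
    linarith
  have hα2 : α * (c + 1) = 2 := by
    rw [hα]
    field_simp
  set N := ‖v‖ ^ 2
  set M := ‖v - f' y‖ ^ 2
  set p := inner ℝ v (x - m)
  set r := inner ℝ (v - f' y) (x - m)
  set j := inner ℝ (v - f' y) v
  have hN : 0 ≤ N := by positivity
  have h₅ : f u' ≤ (1 - α) * f u + α * f m + α * ((p - r) - γ * c * (N - j)) +
      β / 2 * ((α * (γ * c)) ^ 2 * N) := by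
    have a₁ := mul_le_mul_of_nonneg_left h₂ hα1
    have a₂ := mul_le_mul_of_nonneg_left h₃ hα0
    linarith
  have h₆ := mul_le_mul_of_nonneg_left h₅ (by positivity : 0 ≤ γ * ((c + 1) * c))
  have e₇ : γ * ((c + 1) * c) * ((1 - α) * f u + α * f m + α * ((p - r) - γ * c * (N - j)) +
      β / 2 * ((α * (γ * c)) ^ 2 * N)) = γ * (c * (c - 1)) * f u + 2 * γ * c * f m +
      2 * γ * c * ((p - r) - γ * c * (N - j)) + γ ^ 2 * c ^ 2 * (β * γ) * (α * c) * N := by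
    linear_combination (-γ * c * f u + γ * c * f m + γ * c * ((p - r) - γ * c * (N - j)) +
      β / 2 * γ ^ 3 * c ^ 3 * N * α) * hα2
  have h₇ : γ ^ 2 * c ^ 2 * (β * γ) * (α * c) * N ≤ γ ^ 2 * c ^ 2 * (1 / 4) * 2 * N := by
    have : α * c ≤ 2 := by linarith
    gcongr
  have h₈ := mul_le_mul_of_nonneg_left h₄ (by positivity : 0 ≤ 2 * γ ^ 2 * c ^ 2)
  rw [e₇] at h₆
  linarith

/-- The point `x_k` of accelerated SGD after the responses `V 0, …, V (k - 1)`. -/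
noncomputable def acsaPoint (γ : ℝ) (w₁ : E) (V : ℕ → Z → E) (k : ℕ) (z : Z) : E :=
  (acsaIterate γ w₁ (history V k z)).2.1

/-- The average `x̄_k` of accelerated SGD after the responses `V 0, …, V (k - 1)`. -/
noncomputable def acsaAverage (γ : ℝ) (w₁ : E) (V : ℕ → Z → E) (k : ℕ) (z : Z) : E :=
  (acsaIterate γ w₁ (history V k z)).2.2

theorem acsaIterate_append (γ : ℝ) (w₁ : E) (l : List E) (v : E) :
    acsaIterate γ w₁ (l ++ [v]) =
      let p := acsaIterate γ w₁ l
      let t : ℕ := p.1 + 1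
      let α : ℝ := 2 / ((t : ℝ) + 1)
      let x : E := p.2.1 - (γ * (t : ℝ)) • v
      (t, x, (1 - α) • p.2.2 + α • x) := by
  simp [acsaIterate]

theorem acsaIterate_history_fst (γ : ℝ) (w₁ : E) (V : ℕ → Z → E) (k : ℕ) (z : Z) :
    (acsaIterate γ w₁ (history V k z)).1 = k := by
  induction k with
  | zero => rfl
  | succ k ih => rw [history_succ, acsaIterate_append]; simp [ih]

theorem acsaPoint_succ (γ : ℝ) (w₁ : E) (V : ℕ → Z → E) (k : ℕ) (z : Z) :
    acsaPoint γ w₁ V (k + 1) z =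
      acsaPoint γ w₁ V k z - (γ * ((k + 1 : ℕ) : ℝ)) • V k z := by
  simp only [acsaPoint, history_succ, acsaIterate_append, acsaIterate_history_fst]

theorem acsaAverage_succ (γ : ℝ) (w₁ : E) (V : ℕ → Z → E) (k : ℕ) (z : Z) :
    acsaAverage γ w₁ V (k + 1) z =
      (1 - 2 / (((k + 1 : ℕ) : ℝ) + 1)) • acsaAverage γ w₁ V k z +
        (2 / (((k + 1 : ℕ) : ℝ) + 1)) • acsaPoint γ w₁ V (k + 1) z := by
  rw [acsaPoint_succ]
  simp only [acsaPoint, acsaAverage, history_succ, acsaIterate_append, acsaIterate_history_fst]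

theorem acsa_query_history (γ : ℝ) (w₁ : E) (V : ℕ → Z → E) (k : ℕ) (z : Z) :
    (acsa γ w₁).query (history V k z) =
      (1 - 2 / (((k + 1 : ℕ) : ℝ) + 1)) • acsaAverage γ w₁ V k z +
        (2 / (((k + 1 : ℕ) : ℝ) + 1)) • acsaPoint γ w₁ V k z := by
  simp only [acsa, acsaIterate_history_fst, acsaAverage, acsaPoint]

theorem measurable_acsaPoint (γ : ℝ) (w₁ : E) {V : ℕ → Z → E} (k : ℕ)
    (hV : ∀ j < k, Measurable (V j)) : Measurable (acsaPoint γ w₁ V k) := by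
  induction k with
  | zero => exact measurable_const
  | succ k ih =>
    simp_rw [funext (acsaPoint_succ γ w₁ V k)]
    exact (ih fun j hj => hV j (by omega)).sub ((hV k (by omega)).const_smul _)

theorem measurable_acsaAverage (γ : ℝ) (w₁ : E) {V : ℕ → Z → E} (k : ℕ)
    (hV : ∀ j < k, Measurable (V j)) : Measurable (acsaAverage γ w₁ V k) := by
  induction k with
  | zero => exact measurable_const
  | succ k ih =>
    simp_rw [funext (acsaAverage_succ γ w₁ V k)]
    exact ((ih fun j hj => hV j (by omega)).const_smul _).add
      ((measurable_acsaPoint γ w₁ (k + 1) hV).const_smul _)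

theorem measurable_acsa_query (γ : ℝ) (w₁ : E) {V : ℕ → Z → E} (k : ℕ)
    (hV : ∀ j < k, Measurable (V j)) :
    Measurable fun z => (acsa γ w₁).query (history V k z) := by
  simp_rw [acsa_query_history]
  exact ((measurable_acsaAverage γ w₁ k hV).const_smul _).add
    ((measurable_acsaPoint γ w₁ k hV).const_smul _)

theorem acsa_zero_step (w₁ : E) (V : ℕ → Z → E) (k : ℕ) (z : Z) :
    acsaAverage 0 w₁ V k z = w₁ := by
  have hx : ∀ k, acsaPoint 0 w₁ V k z = w₁ := fun k => by
    induction k with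
    | zero => rfl
    | succ k ih => rw [acsaPoint_succ, ih]; simp
  induction k with
  | zero => rfl
  | succ k ih =>
    rw [acsaAverage_succ, ih, hx, ← add_smul]
    simp

theorem IsStochasticResponses.memLp_acsa (h : IsStochasticResponses ν (acsa γ w₁) f' s K V)
    (hβ : ∀ x y, ‖f' x - f' y‖ ≤ β * ‖x - y‖) {k : ℕ} (hk : k ≤ K) :
    MemLp (acsaPoint γ w₁ V k) 2 ν ∧ MemLp (acsaAverage γ w₁ V k) 2 ν := by
  induction k with
  | zero => exact ⟨memLp_const _, memLp_const _⟩
  | succ k ih =>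
    obtain ⟨h₁, h₂⟩ := ih (by omega)
    have hQ : MemLp (fun z => (acsa γ w₁).query (history V k z)) 2 ν := by
      simp_rw [acsa_query_history]
      exact (h₂.const_smul _).add (h₁.const_smul _)
    have hx : MemLp (acsaPoint γ w₁ V (k + 1)) 2 ν := by
      rw [funext (acsaPoint_succ γ w₁ V k)]
      exact h₁.sub ((h.memLp_response hβ hk hQ).const_smul _)
    refine ⟨hx, ?_⟩
    rw [funext (acsaAverage_succ γ w₁ V k)]
    exact (h₂.const_smul _).add (hx.const_smul _)

theorem IsStochasticResponses.acsa_convex (h : IsStochasticResponses ν (acsa γ w₁) f' s K V)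
    (hf : ∀ x, HasGradientAt f (f' x) x) (hβ0 : 0 < β)
    (hβ : ∀ x y, ‖f' x - f' y‖ ≤ β * ‖x - y‖) (hconv : ConvexOn ℝ Set.univ f)
    {m : E} (hm : ∀ x, f m ≤ f x) (hγ0 : 0 ≤ γ) (hγ : γ ≤ 1 / (4 * β)) :
    γ * ((K + 1) * K) * ∫ z, (f (acsaAverage γ w₁ V K z) - f m) ∂ν ≤
      ‖w₁ - m‖ ^ 2 + 2 * K ^ 3 * (s ^ 2 * γ ^ 2) := by
  have hxL : ∀ k ≤ K, MemLp (acsaPoint γ w₁ V k) 2 ν := fun k hk => (h.memLp_acsa hβ hk).1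
  have huL : ∀ k ≤ K, MemLp (acsaAverage γ w₁ V k) 2 ν := fun k hk => (h.memLp_acsa hβ hk).2
  have hxm : ∀ k ≤ K, MemLp (fun z => acsaPoint γ w₁ V k z - m) 2 ν := fun k hk =>
    (hxL k hk).sub (memLp_const m)
  have hfi : ∀ k ≤ K, Integrable (fun z => f (acsaAverage γ w₁ V k z) - f m) ν := fun k hk =>
    (integrable_comp_of_lipschitz_gradient hf hβ hm (huL k hk)).sub (integrable_const _)
  have hni : ∀ k ≤ K, Integrable (fun z => ‖acsaPoint γ w₁ V k z - m‖ ^ 2) ν := fun k hk =>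
    (hxm k hk).integrable_norm_pow two_ne_zero
  set a : ℕ → ℝ := fun k => ∫ z, (‖acsaPoint γ w₁ V k z - m‖ ^ 2 +
    γ * ((k + 1) * k) * (f (acsaAverage γ w₁ V k z) - f m)) ∂ν with ha
  have haK : ∀ k ≤ K, a k = ∫ z, ‖acsaPoint γ w₁ V k z - m‖ ^ 2 ∂ν +
      γ * ((k + 1) * k) * ∫ z, (f (acsaAverage γ w₁ V k z) - f m) ∂ν := fun k hk => by
    rw [ha, ← integral_const_mul]
    exact integral_add (hni k hk) ((hfi k hk).const_mul _)
  have hstep : ∀ k < K, a (k + 1) + 0 ≤ a k + 2 * K ^ 2 * (s ^ 2 * γ ^ 2) := by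
    intro k hk
    have hpt : ∀ z, ‖acsaPoint γ w₁ V (k + 1) z - m‖ ^ 2 + γ * (((k + 1 : ℕ) + 1) * (k + 1 : ℕ)) *
        (f (acsaAverage γ w₁ V (k + 1) z) - f m) ≤
        (‖acsaPoint γ w₁ V k z - m‖ ^ 2 +
          γ * ((k + 1) * k) * (f (acsaAverage γ w₁ V k z) - f m)) +
          inner ℝ (V k z - f' ((acsa γ w₁).query (history V k z)))
            (-(2 * γ * (k + 1 : ℕ)) • (acsaPoint γ w₁ V k z - m)) +
          2 * γ ^ 2 * ((k + 1 : ℕ) : ℝ) ^ 2 *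
            ‖V k z - f' ((acsa γ w₁).query (history V k z))‖ ^ 2 + 0 := by
      intro z
      have := acsa_step hf hβ0 hβ hconv hγ0 hγ (c := ((k + 1 : ℕ) : ℝ)) (by simp) rfl m
        (acsa_query_history γ w₁ V k z) (acsaPoint_succ γ w₁ V k z)
        (acsaAverage_succ γ w₁ V k z)
      have e : ((k + 1 : ℕ) : ℝ) * (((k + 1 : ℕ) : ℝ) - 1) = (k + 1) * k := by
        push_cast
        ring
      rw [e] at this
      linarith
    have hstep' := h.integral_step hk
      (φ := fun l => -(2 * γ * (k + 1 : ℕ)) • ((acsaIterate γ w₁ l).2.1 - m))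
      ((hni k hk.le).add ((hfi k hk.le).const_mul _)) (hfi (k + 1) hk) (hni (k + 1) hk)
      ((hxm k hk.le).const_smul _) (by positivity) hpt
    rw [← haK (k + 1) hk] at hstep'
    -- Bounding each squared step number by `K²` loses only a constant factor after summation.
    have hsq : ((k + 1 : ℕ) : ℝ) ^ 2 ≤ (K : ℝ) ^ 2 := by
      have : ((k + 1 : ℕ) : ℝ) ≤ K := by exact_mod_cast hk
      gcongr
    have := mul_le_mul_of_nonneg_right hsq (by positivity : 0 ≤ 2 * γ ^ 2 * s ^ 2)
    simp only [Pi.add_apply] at hstep'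
    have e : ∫ z, (‖acsaPoint γ w₁ V k z - m‖ ^ 2 +
          γ * ((k + 1) * k) * (f (acsaAverage γ w₁ V k z) - f m)) ∂ν = a k := rfl
    rw [e] at hstep'
    linarith
  have hsum := sum_le_of_forall_add_le (a := a) (c := fun _ => 0)
    (e := fun _ => 2 * (K : ℝ) ^ 2 * (s ^ 2 * γ ^ 2)) hstep
  rw [Finset.sum_const, Finset.sum_const, Finset.card_range, nsmul_eq_mul, nsmul_eq_mul,
    haK K le_rfl,
    haK 0 (Nat.zero_le _)] at hsum
  have h₀ : ∫ z, ‖acsaPoint γ w₁ V 0 z - m‖ ^ 2 ∂ν = ‖w₁ - m‖ ^ 2 := by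
    simp [acsaPoint, history_zero, acsaIterate]
  have hK : 0 ≤ ∫ z, ‖acsaPoint γ w₁ V K z - m‖ ^ 2 ∂ν := integral_nonneg fun z => by positivity
  rw [h₀] at hsum
  simp only [CharP.cast_eq_zero, mul_zero, zero_mul, add_zero] at hsum
  linarith

end AcceleratedSGD

/-! ### Projected SGD. -/

section ProjectedSGD

variable {E Z : Type*} [NormedAddCommGroup E] [InnerProductSpace ℝ E] [CompleteSpace E]
  [MeasurableSpace E] [BorelSpace E] [SecondCountableTopology E] [MeasurableSpace Z]
  {ν : Measure Z} [IsProbabilityMeasure ν] {W : Set E} {f : E → ℝ} {f' : E → E} {G γ s : ℝ}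
  {w₁ : E} {K : ℕ} {V : ℕ → Z → E}

/-- The variational inequality of the projection is tested at `m`. The gradient part of the
displacement `u - w` is bounded by `G ‖u - w‖`, which is legitimate because `u ∈ W` makes the
direction feasible. -/
theorem psgd_step (hf : ∀ w ∈ W, HasGradientWithinAt f (f' w) W w) (hW : IsClosed W)
    (hconv : ConvexOn ℝ W f) (hG : ∀ x ∈ W, ∀ y ∈ W, |f x - f y| ≤ G * ‖x - y‖)
    (hγ0 : 0 ≤ γ) {w m : E} (hw : w ∈ W) (hm : m ∈ W) (v : E) :
    ‖nearestPoint W (w - γ • v) - m‖ ^ 2 + 2 * γ * (f w - f m) ≤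
      ‖w - m‖ ^ 2 + inner ℝ (v - f' w) (-(2 * γ) • (w - m)) + 2 * γ ^ 2 * ‖v - f' w‖ ^ 2 +
        2 * γ ^ 2 * G ^ 2 := by
  have hu : nearestPoint W (w - γ • v) ∈ W := (nearestPoint_spec hW hconv.1 ⟨w, hw⟩ _).1
  have h₁ := inner_sub_nearestPoint_nonpos hW hconv.1 (w - γ • v) hm
  set u := nearestPoint W (w - γ • v)
  have h₂ := hconv.add_inner_le (hf w hw) hw hm
  have h₃ := neg_le_of_abs_le ((hf w hw).abs_inner_le_of_lipschitz hconv.1 hG hw hu)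
  have h₄ := neg_le_of_abs_le (abs_real_inner_le_norm (v - f' w) (u - w))
  have e₁ : w - m = (u - m) - (u - w) := by abel
  have e₂ : inner ℝ (w - γ • v - u) (m - u) =
      inner ℝ (u - w) (u - m) + γ * (inner ℝ (v - f' w) (u - w) + inner ℝ (f' w) (u - w) +
        inner ℝ (v - f' w) (w - m) - inner ℝ (f' w) (m - w)) := by
    have a₁ : w - γ • v - u = -((u - w) + γ • v) := by abel
    have a₂ : m - u = -(u - m) := by abel
    have a₃ : inner ℝ v (u - m) = inner ℝ (v - f' w) (u - w) + inner ℝ (f' w) (u - w) +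
        inner ℝ (v - f' w) (w - m) - inner ℝ (f' w) (m - w) := by
      rw [← inner_add_left, sub_add_cancel, ← neg_sub w m, inner_neg_right, sub_neg_eq_add,
        add_assoc, ← inner_add_left, sub_add_cancel, ← inner_add_right]
      congr 1
      abel
    rw [a₁, a₂, inner_neg_neg, inner_add_left, inner_smul_left, a₃]
    rfl
  rw [e₂] at h₁
  have e₃ : ‖w - m‖ ^ 2 = ‖u - m‖ ^ 2 - 2 * inner ℝ (u - w) (u - m) + ‖u - w‖ ^ 2 := by
    rw [e₁, norm_sub_sq_real, real_inner_comm]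
  rw [e₃, inner_smul_right]
  have h₅ := mul_le_mul_of_nonneg_left h₂ hγ0
  have h₆ := mul_le_mul_of_nonneg_left h₃ hγ0
  have h₇ := mul_le_mul_of_nonneg_left h₄ hγ0
  -- Complete the square in `‖u - w‖` against `-‖u - w‖²`, then use `(G + ‖δ‖)² ≤ 2 G² + 2 ‖δ‖²` for
  -- the noise `δ`.
  nlinarith [sq_nonneg (‖u - w‖ - γ * (G + ‖v - f' w‖)), sq_nonneg (γ * (G - ‖v - f' w‖))]

theorem psgdIterate_history_succ (W : Set E) (γ : ℝ) (w₁ : E) (V : ℕ → Z → E) (k : ℕ) (z : Z) :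
    psgdIterate W γ w₁ (history V (k + 1) z) =
      nearestPoint W (psgdIterate W γ w₁ (history V k z) - γ • V k z) := by
  simp [history_succ, psgdIterate]

theorem psgdIterate_mem (hW : IsClosed W) (hconv : Convex ℝ W) (γ : ℝ) (hw₁ : w₁ ∈ W)
    (l : List E) : psgdIterate W γ w₁ l ∈ W := by
  unfold psgdIterate
  induction l generalizing w₁ with
  | nil => exact hw₁
  | cons v l ih => exact ih (nearestPoint_spec hW hconv ⟨w₁, hw₁⟩ _).1

theorem measurable_psgdIterate_history (hW : IsClosed W) (hconv : Convex ℝ W) (γ : ℝ)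
    (hw₁ : w₁ ∈ W) {V : ℕ → Z → E} (k : ℕ) (hV : ∀ j < k, Measurable (V j)) :
    Measurable fun z => psgdIterate W γ w₁ (history V k z) := by
  induction k with
  | zero => exact measurable_const
  | succ k ih =>
    simp_rw [psgdIterate_history_succ]
    exact (lipschitzWith_nearestPoint hW hconv ⟨w₁, hw₁⟩).continuous.measurable.comp
      ((ih fun j hj => hV j (by omega)).sub ((hV k (by omega)).const_smul γ))

theorem continuousOn_of_hasGradientWithinAt (hf : ∀ w ∈ W, HasGradientWithinAt f (f' w) W w) :
    ContinuousOn f W := fun w hw => (hf w hw).continuousWithinAt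

theorem integrable_comp_sub_of_lipschitzOn {D : ℝ}
    (hf : ContinuousOn f W) (hD : ∀ x ∈ W, ∀ y ∈ W, ‖x - y‖ ≤ D) (hG0 : 0 ≤ G)
    (hG : ∀ x ∈ W, ∀ y ∈ W, |f x - f y| ≤ G * ‖x - y‖) {m : E} (hm : m ∈ W) {X : Z → E}
    (hX : Measurable X) (hXW : ∀ z, X z ∈ W) : Integrable (fun z => f (X z) - f m) ν := by
  have hmeas : Measurable fun z => f (X z) :=
    hf.domRestrict.measurable.comp (hX.subtype_mk (h := hXW))
  refine Integrable.of_bound (hmeas.sub_const _).aestronglyMeasurable (G * D)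
    (ae_of_all _ fun z => ?_)
  exact (hG _ (hXW z) _ hm).trans (mul_le_mul_of_nonneg_left (hD _ (hXW z) _ hm) hG0)

theorem IsStochasticResponses.psgd_convex (h : IsStochasticResponses ν (psgd W γ w₁) f' s K V)
    (hf : ∀ w ∈ W, HasGradientWithinAt f (f' w) W w) (hW : IsClosed W)
    (hconv : ConvexOn ℝ W f) {D : ℝ} (hD : ∀ x ∈ W, ∀ y ∈ W, ‖x - y‖ ≤ D) (hG0 : 0 ≤ G)
    (hG : ∀ x ∈ W, ∀ y ∈ W, |f x - f y| ≤ G * ‖x - y‖) (hγ0 : 0 ≤ γ) (hw₁ : w₁ ∈ W)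
    {m : E} (hm : m ∈ W) :
    2 * γ * ∑ k ∈ Finset.range K, ∫ z, (f (psgdIterate W γ w₁ (history V k z)) - f m) ∂ν ≤
      D ^ 2 + K * (2 * (G ^ 2 + s ^ 2) * γ ^ 2) := by
  set X : ℕ → Z → E := fun k z => psgdIterate W γ w₁ (history V k z) with hX
  have hXm : ∀ k, Measurable (X k) := fun k =>
    measurable_psgdIterate_history hW hconv.1 γ hw₁ k fun j _ => h.measurable j
  have hXW : ∀ k z, X k z ∈ W := fun k z => psgdIterate_mem hW hconv.1 γ hw₁ _
  have hL : ∀ k, MemLp (fun z => X k z - m) 2 ν := fun k =>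
    MemLp.of_bound ((hXm k).sub_const m).aestronglyMeasurable D
      (ae_of_all _ fun z => hD _ (hXW k z) _ hm)
  have hni : ∀ k, Integrable (fun z => ‖X k z - m‖ ^ 2) ν := fun k =>
    (hL k).integrable_norm_pow two_ne_zero
  have hstep : ∀ k < K, ∫ z, ‖X (k + 1) z - m‖ ^ 2 ∂ν + 2 * γ * ∫ z, (f (X k z) - f m) ∂ν ≤
      ∫ z, ‖X k z - m‖ ^ 2 ∂ν + 2 * (G ^ 2 + s ^ 2) * γ ^ 2 := by
    intro k hk
    have hpt : ∀ z, ‖X (k + 1) z - m‖ ^ 2 + 2 * γ * (f (X k z) - f m) ≤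
        ‖X k z - m‖ ^ 2 + inner ℝ (V k z - f' (X k z)) (-(2 * γ) • (X k z - m)) +
          2 * γ ^ 2 * ‖V k z - f' (X k z)‖ ^ 2 + 2 * γ ^ 2 * G ^ 2 := fun z => by
      simp only [hX, psgdIterate_history_succ]
      exact psgd_step hf hW hconv hG hγ0 (hXW k z) hm (V k z)
    have := h.integral_step hk (hni k)
      (integrable_comp_sub_of_lipschitzOn (continuousOn_of_hasGradientWithinAt hf) hD hG0 hG hm
        (hXm k) (hXW k)) (hni (k + 1))
      (φ := fun l => -(2 * γ) • (psgdIterate W γ w₁ l - m)) ((hL k).const_smul _)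
      (by positivity) hpt
    linarith
  have hsum := sum_le_of_forall_add_le (a := fun k => ∫ z, ‖X k z - m‖ ^ 2 ∂ν)
    (c := fun k => 2 * γ * ∫ z, (f (X k z) - f m) ∂ν)
    (e := fun _ => 2 * (G ^ 2 + s ^ 2) * γ ^ 2) hstep
  rw [← Finset.mul_sum, Finset.sum_const, Finset.card_range, nsmul_eq_mul] at hsum
  have h₀ : ∫ z, ‖X 0 z - m‖ ^ 2 ∂ν = ‖w₁ - m‖ ^ 2 := by simp [hX, history_zero, psgdIterate]
  have hK : 0 ≤ ∫ z, ‖X K z - m‖ ^ 2 ∂ν := integral_nonneg fun z => by positivity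
  have hD' : ‖w₁ - m‖ ^ 2 ≤ D ^ 2 := by
    have := hD _ hw₁ _ hm
    gcongr
  rw [h₀] at hsum
  linarith

end ProjectedSGD

/-! ### The random output index. -/

/-- The index affects only the output, never a query. The response process can therefore be analysed
with a fixed index and stays a function of the seeds alone. -/
theorem batchResponses_sgd {E Ξ : Type*} [AddCommGroup E] [Module ℝ E] (γ : ℝ) (w₁ : E)
    (r r' : ℕ) (g : E → Ξ → E) (S : ℕ → Finset ℕ) (B : ℕ) (z : ℕ → Ξ) (k : ℕ) :
    batchResponses (sgd γ w₁ r) g S B z k = batchResponses (sgd γ w₁ r') g S B z k := by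
  induction k with
  | zero => rfl
  | succ k ih =>
    simp only [batchResponses]
    rw [ih]
    rfl

section UniformIndex

variable {Ω Ξ : Type*} [MeasurableSpace Ω] [MeasurableSpace Ξ] {μ : Measure Ω}
  [IsProbabilityMeasure μ] {P : Measure Ξ} [IsProbabilityMeasure P] {ξ : ℕ → Ω → Ξ}

theorem IsIIDSeeds.measurePreserving (hξ : IsIIDSeeds μ P ξ) :
    MeasurePreserving (fun ω t => ξ t ω) μ (Measure.infinitePi fun _ : ℕ => P) :=
  ⟨measurable_pi_iff.2 hξ.measurable, hξ.map_eq_infinitePi⟩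

/-- The `K` prescribed probabilities sum to one, so almost surely `1 ≤ R ≤ K`. Splitting over the
value of `R`, independence factors each integral. -/
theorem IsUniformIndex.integral_eq (hξ : IsIIDSeeds μ P ξ) {K : ℕ} (hK : 0 < K) {R : Ω → ℕ}
    (hR : IsUniformIndex μ ξ K R) {h : ℕ → (ℕ → Ξ) → ℝ} (hm : ∀ k, Measurable (h k))
    (hi : ∀ k < K, Integrable (h k) (Measure.infinitePi fun _ : ℕ => P)) :
    Integrable (fun ω => h (min (R ω - 1) K) fun t => ξ t ω) μ ∧
    ∫ ω, h (min (R ω - 1) K) (fun t => ξ t ω) ∂μ =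
      1 / (K : ℝ) * ∑ k ∈ Finset.range K, ∫ z, h k z ∂(Measure.infinitePi fun _ : ℕ => P) := by
  have hmp := hξ.measurePreserving
  have hS : ∀ k, MeasurableSet (R ⁻¹' {k}) := fun k =>
    hR.measurable (measurableSet_singleton k)
  have hprob : ∀ᵐ ω ∂μ, R ω ∈ Finset.Icc 1 K := by
    have h₁ : μ.real (R ⁻¹' (Finset.Icc 1 K : Finset ℕ)) = 1 := by
      rw [← sum_measureReal_preimage_singleton _ (fun k _ => hS k),
        Finset.sum_congr rfl hR.law]
      have : (K : ℝ) ≠ 0 := by positivity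
      simp [this]
    have h₂ : μ (R ⁻¹' (Finset.Icc 1 K : Finset ℕ)) = 1 := by
      rwa [measureReal_def, ENNReal.toReal_eq_one_iff] at h₁
    exact (mem_ae_iff_prob_eq_one (hR.measurable (Finset.measurableSet _))).2 h₂
  have hae : (fun ω => ∑ k ∈ Finset.range K,
      (R ⁻¹' {k + 1}).indicator (fun ω => h k fun t => ξ t ω) ω) =ᵐ[μ]
      fun ω => h (min (R ω - 1) K) fun t => ξ t ω := by
    filter_upwards [hprob] with ω hω
    rw [Finset.mem_Icc] at hω
    rw [Finset.sum_eq_single_of_mem (R ω - 1) (Finset.mem_range.2 (by omega))]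
    · rw [Set.indicator_of_mem (by simp; omega), min_eq_left (by omega)]
    · intro k _ hk
      exact Set.indicator_of_notMem (by simp; omega) _
  have hi' : ∀ k < K, Integrable (fun ω => h k fun t => ξ t ω) μ := fun k hk =>
    hmp.integrable_comp_of_integrable (hi k hk)
  have hind : ∀ k ∈ Finset.range K,
      Integrable ((R ⁻¹' {k + 1}).indicator fun ω => h k fun t => ξ t ω) μ :=
    fun k hk => (hi' k (Finset.mem_range.1 hk)).indicator (hS _)
  refine ⟨(integrable_finsetSum _ hind).congr hae, ?_⟩
  rw [← integral_congr_ae hae, integral_finsetSum _ hind, Finset.mul_sum]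
  refine Finset.sum_congr rfl fun k hk => ?_
  rw [Finset.mem_range] at hk
  have hψ : Measurable fun j : ℕ => ({k + 1} : Set ℕ).indicator (fun _ => (1 : ℝ)) j :=
    measurable_of_countable _
  have hindep := hR.indep.comp hψ (hm k)
  have hmul := hindep.integral_fun_mul_eq_mul_integral
    (hψ.comp hR.measurable).aestronglyMeasurable
    ((hm k).comp hmp.measurable).aestronglyMeasurable
  have e₁ : ∀ ω, (R ⁻¹' {k + 1}).indicator (fun ω => h k fun t => ξ t ω) ω =
      ((fun j : ℕ => ({k + 1} : Set ℕ).indicator (fun _ => (1 : ℝ)) j) ∘ R) ω *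
        ((h k) ∘ fun ω t => ξ t ω) ω := fun ω => by
    by_cases hω : R ω = k + 1 <;> simp [Set.indicator, hω]
  have e₂ : ∫ ω, ((fun j : ℕ => ({k + 1} : Set ℕ).indicator (fun _ => (1 : ℝ)) j) ∘ R) ω ∂μ =
      1 / K := by
    rw [← hR.law (k + 1) (Finset.mem_Icc.2 (by omega)), ← integral_indicator_one (hS (k + 1))]
    rfl
  have e₃ : ∫ ω, ((h k) ∘ fun ω t => ξ t ω) ω ∂μ =
      ∫ z, h k z ∂(Measure.infinitePi fun _ : ℕ => P) := by
    rw [← hmp.map_eq, integral_map hmp.measurable.aemeasurable (hm k).aestronglyMeasurable]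
    rfl
  simp_rw [e₁]
  rw [hmul, e₂, e₃]

end UniformIndex

/-! ### Bounds in terms of `K` and `s` with the prescribed step sizes. -/

section Rates

variable {E Z : Type*} [NormedAddCommGroup E] [InnerProductSpace ℝ E] [CompleteSpace E]
  [MeasurableSpace E] [BorelSpace E] [SecondCountableTopology E] [MeasurableSpace Z]
  {ν : Measure Z} [IsProbabilityMeasure ν] {f : E → ℝ} {f' : E → E} {β D s : ℝ} {w₁ : E}
  {K r : ℕ} {V : ℕ → Z → E}

theorem sum_div_le_of_forall_le {b : ℝ} {c : ℕ → ℝ} (hK : 0 < K) (h : ∀ k < K, c k ≤ b) :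
    1 / (K : ℝ) * ∑ k ∈ Finset.range K, c k ≤ b := by
  have hK' : (0 : ℝ) < K := by exact_mod_cast hK
  have := Finset.sum_le_sum fun k hk => h k (Finset.mem_range.1 hk)
  rw [Finset.sum_const, Finset.card_range, nsmul_eq_mul] at this
  rw [one_div, inv_mul_le_iff₀ hK']
  exact this

theorem IsStochasticResponses.sgd_nonconvex_rate {F c : ℝ}
    (h : IsStochasticResponses ν (sgd (sgdStepNonconvex β F s K) w₁ r) f' s K V)
    (hf : ∀ x, HasGradientAt f (f' x) x) (hβ0 : 0 < β)
    (hβ : ∀ x y, ‖f' x - f' y‖ ≤ β * ‖x - y‖) (hc : ∀ x, c ≤ f x) (hF : f w₁ - c ≤ F)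
    (hK : 0 < K) :
    1 / (K : ℝ) * ∑ k ∈ Finset.range K,
      ∫ z, ‖f' (sgdIterate (sgdStepNonconvex β F s K) w₁ (history V k z))‖ ^ 2 ∂ν ≤
      2 * F / K * β + 2 * √(2 * F / K * (β * s ^ 2)) := by
  have hK' : (0 : ℝ) < K := by exact_mod_cast hK
  have hF0 : 0 ≤ F := (sub_nonneg.2 (hc w₁)).trans hF
  have hγ : sgdStepNonconvex β F s K =
      if β * s ^ 2 = 0 then 1 / β else min (1 / β) √(2 * F / K / (β * s ^ 2)) := by
    have e : 2 * F / (s ^ 2 * β * K) = 2 * F / K / (β * s ^ 2) := by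
      rw [div_div]
      congr 1
      ring
    rw [sgdStepNonconvex, e]
    simp [hβ0.ne']
  have hγ0 : 0 ≤ sgdStepNonconvex β F s K := by rw [hγ]; split_ifs <;> positivity
  have hγ1 : sgdStepNonconvex β F s K ≤ 1 / β := by
    rw [hγ]
    split_ifs
    exacts [le_rfl, min_le_left _ _]
  by_cases hab : β * s ^ 2 = 0 ∨ 0 < 2 * F / K
  · refine le_of_step_mul_le hβ0 (by positivity) hab hγ ?_
    have := h.sgd_nonconvex hf hβ0 hβ hc hγ0 hγ1
    rw [mul_left_comm, one_div, inv_mul_le_iff₀ hK', mul_add, mul_div_cancel₀ _ hK'.ne']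
    linarith
  -- Here `s ≠ 0` and `F = 0`: the step is zero, and `w₁` attains the lower bound `c`, so its
  -- gradient vanishes.
  · rw [not_or] at hab
    have hF1 : F = 0 := by
      refine le_antisymm (not_lt.1 fun hlt => hab.2 (by positivity)) hF0
    have hγ2 : sgdStepNonconvex β F s K = 0 := by
      rw [hγ, if_neg hab.1, hF1]
      simp [hβ0.le]
    refine sum_div_le_of_forall_le hK fun k _ => ?_
    simp_rw [hγ2, sgdIterate_zero_step, integral_const]
    have h₁ := norm_gradient_sq_le_of_lipschitz_gradient hf hβ0 hβ hc w₁
    have h₂ : 2 * β * (f w₁ - c) ≤ 2 * β * F := mul_le_mul_of_nonneg_left hF (by positivity)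
    rw [hF1, mul_zero] at h₂
    refine le_trans ?_ (by positivity : 0 ≤ 2 * F / K * β + 2 * √(2 * F / K * (β * s ^ 2)))
    simpa using h₁.trans h₂

theorem IsStochasticResponses.sgd_convex_rate
    (h : IsStochasticResponses ν (sgd (sgdStepConvex β D s K) w₁ r) f' s K V)
    (hf : ∀ x, HasGradientAt f (f' x) x) (hβ0 : 0 < β)
    (hβ : ∀ x y, ‖f' x - f' y‖ ≤ β * ‖x - y‖) (hconv : ConvexOn ℝ Set.univ f)
    {m : E} (hm : ∀ x, f m ≤ f x) (hD : ‖w₁ - m‖ ≤ D) (hK : 0 < K) :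
    1 / (K : ℝ) * ∑ k ∈ Finset.range K,
      ∫ z, (f (sgdIterate (sgdStepConvex β D s K) w₁ (history V k z)) - f m) ∂ν ≤
      D ^ 2 / K * β + 2 * √(D ^ 2 / K * s ^ 2) := by
  have hK' : (0 : ℝ) < K := by exact_mod_cast hK
  have hD0 : 0 ≤ D := (norm_nonneg _).trans hD
  have hγ : sgdStepConvex β D s K =
      if s ^ 2 = 0 then 1 / β else min (1 / β) √(D ^ 2 / K / s ^ 2) := by
    have e : D ^ 2 / (s ^ 2 * K) = D ^ 2 / K / s ^ 2 := by
      rw [div_div]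
      congr 1
      ring
    rw [sgdStepConvex, e]
    simp
  have hγ0 : 0 ≤ sgdStepConvex β D s K := by rw [hγ]; split_ifs <;> positivity
  have hγ1 : sgdStepConvex β D s K ≤ 1 / β := by
    rw [hγ]
    split_ifs
    exacts [le_rfl, min_le_left _ _]
  by_cases hab : s ^ 2 = 0 ∨ 0 < D ^ 2 / K
  · refine le_of_step_mul_le hβ0 (by positivity) hab hγ ?_
    have := h.sgd_convex hf hβ0 hβ hconv hm hγ0 hγ1
    rw [mul_left_comm, one_div, inv_mul_le_iff₀ hK', mul_add, mul_div_cancel₀ _ hK'.ne']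
    have h₁ : ‖w₁ - m‖ ^ 2 ≤ D ^ 2 := by gcongr
    have h₂ : 0 ≤ (K : ℝ) * (s ^ 2 * sgdStepConvex β D s K ^ 2) := by positivity
    nlinarith [sq_nonneg D]
  -- Here `s ≠ 0` and `D = 0`: the iterates never leave `w₁ = m`.
  · rw [not_or] at hab
    have hD1 : D = 0 := by
      refine le_antisymm (not_lt.1 fun hlt => hab.2 (by positivity)) hD0
    have hγ2 : sgdStepConvex β D s K = 0 := by
      rw [hγ, if_neg hab.1, hD1]
      simp [hβ0.le]
    have hw : w₁ = m := by
      rw [hD1] at hD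
      exact sub_eq_zero.1 (norm_le_zero_iff.1 hD)
    refine sum_div_le_of_forall_le hK fun k _ => ?_
    simp_rw [hγ2, sgdIterate_zero_step, hw, sub_self, integral_zero]
    positivity

theorem IsStochasticResponses.acsa_rate
    (h : IsStochasticResponses ν (acsa (acsaStep β D s K) w₁) f' s K V)
    (hf : ∀ x, HasGradientAt f (f' x) x) (hβ0 : 0 < β)
    (hβ : ∀ x y, ‖f' x - f' y‖ ≤ β * ‖x - y‖) (hconv : ConvexOn ℝ Set.univ f)
    {m : E} (hm : ∀ x, f m ≤ f x) (hD : ‖w₁ - m‖ ≤ D) (hK : 0 < K) :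
    ∫ z, (f (acsaAverage (acsaStep β D s K) w₁ V K z) - f m) ∂ν ≤
      3 / 2 * (D ^ 2 / ((K + 1) * K) * (4 * β) +
        2 * √(D ^ 2 / ((K + 1) * K) * (4 / 3 * s ^ 2 * (K + 1)))) := by
  have hK' : (0 : ℝ) < K := by exact_mod_cast hK
  have hD0 : 0 ≤ D := (norm_nonneg _).trans hD
  have hγ : acsaStep β D s K = if 4 / 3 * s ^ 2 * ((K : ℝ) + 1) = 0 then 1 / (4 * β) else
      min (1 / (4 * β)) √(D ^ 2 / (((K : ℝ) + 1) * K) / (4 / 3 * s ^ 2 * ((K : ℝ) + 1))) := by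
    have h0 : 4 / 3 * s ^ 2 * ((K : ℝ) + 1) = 0 ↔ s = 0 := by
      have : (K : ℝ) + 1 ≠ 0 := by positivity
      simp [this]
    rw [acsaStep]
    by_cases hs : s = 0
    · rw [if_pos hs, if_pos (h0.2 hs)]
    · rw [if_neg hs, if_neg fun h => hs (h0.1 h)]
      congr 2
      field_simp
  have hγ0 : 0 ≤ acsaStep β D s K := by rw [hγ]; split_ifs <;> positivity
  have hγ1 : acsaStep β D s K ≤ 1 / (4 * β) := by
    rw [hγ]
    split_ifs
    exacts [le_rfl, min_le_left _ _]
  by_cases hab : 4 / 3 * s ^ 2 * ((K : ℝ) + 1) = 0 ∨ 0 < D ^ 2 / (((K : ℝ) + 1) * K)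
  -- Scaling by `2/3` turns the noise constant `2` of `acsa_convex` into the `4/3` for which the
  -- prescribed step is `√(a / b)`.
  · rw [← inv_mul_le_iff₀ (by norm_num : (0 : ℝ) < 3 / 2)]
    refine le_of_step_mul_le (by positivity) (by positivity) hab hγ ?_
    have hmain := h.acsa_convex hf hβ0 hβ hconv hm hγ0 hγ1
    have h₁ : ‖w₁ - m‖ ^ 2 ≤ D ^ 2 := by gcongr
    set I := ∫ z, (f (acsaAverage (acsaStep β D s K) w₁ V K z) - f m) ∂ν
    set γ := acsaStep β D s K
    have hKK : (0 : ℝ) < (K + 1) * K := by positivity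
    refine le_of_mul_le_mul_left ?_ hKK
    rw [mul_add, mul_div_cancel₀ _ hKK.ne']
    have h₂ : 0 ≤ (K : ℝ) ^ 2 * (s ^ 2 * γ ^ 2) := by positivity
    have h₃ : 0 ≤ (K : ℝ) * (s ^ 2 * γ ^ 2) := by positivity
    nlinarith [sq_nonneg D]
  · rw [not_or] at hab
    have hD1 : D = 0 := by
      refine le_antisymm (not_lt.1 fun hlt => hab.2 (by positivity)) hD0
    have hγ2 : acsaStep β D s K = 0 := by
      rw [hγ, if_neg hab.1, hD1]
      simp [hβ0.le]
    have hw : w₁ = m := by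
      rw [hD1] at hD
      exact sub_eq_zero.1 (norm_le_zero_iff.1 hD)
    simp_rw [hγ2, acsa_zero_step, hw, sub_self, integral_zero]
    positivity

theorem IsStochasticResponses.psgd_rate {W : Set E} {G : ℝ}
    (h : IsStochasticResponses ν (psgd W (psgdStep D G s K) w₁) f' s K V)
    (hf : ∀ w ∈ W, HasGradientWithinAt f (f' w) W w) (hW : IsClosed W)
    (hconv : ConvexOn ℝ W f) (hD0 : 0 < D) (hD : ∀ x ∈ W, ∀ y ∈ W, ‖x - y‖ ≤ D) (hG0 : 0 ≤ G)
    (hG : ∀ x ∈ W, ∀ y ∈ W, |f x - f y| ≤ G * ‖x - y‖) (hw₁ : w₁ ∈ W)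
    {m : E} (hm : m ∈ W) (hK : 0 < K) :
    1 / (K : ℝ) * ∑ k ∈ Finset.range K,
      ∫ z, (f (psgdIterate W (psgdStep D G s K) w₁ (history V k z)) - f m) ∂ν ≤
      2 * √(D ^ 2 / K * (G ^ 2 + s ^ 2)) := by
  have hK' : (0 : ℝ) < K := by exact_mod_cast hK
  have hmem := fun k z => psgdIterate_mem hW hconv.1 (psgdStep D G s K) hw₁ (history V k z)
  rcases (by positivity : 0 ≤ G ^ 2 + s ^ 2).eq_or_lt with h0 | h0
  -- With `G = s = 0` the step is the default value `D / 0 = 0`, but it does not matter: `f` is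
  -- constant on `W`.
  · have hG1 : G = 0 := by nlinarith [sq_nonneg G, sq_nonneg s]
    refine sum_div_le_of_forall_le hK fun k _ => ?_
    refine le_trans (integral_nonpos fun z => ?_) (by positivity)
    have := (le_abs_self _).trans (hG _ (hmem k z) _ hm)
    simpa [hG1] using this
  · have hp : 0 < √((G ^ 2 + s ^ 2) * K) := by positivity
    have hγ0 : 0 < psgdStep D G s K := by unfold psgdStep; positivity
    have hmain := h.psgd_convex hf hW hconv hD hG0 hG hγ0.le hw₁ hm
    have hsq := Real.sq_sqrt (by positivity : 0 ≤ (G ^ 2 + s ^ 2) * K)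
    have hγp : psgdStep D G s K * √((G ^ 2 + s ^ 2) * K) = D := div_mul_cancel₀ _ hp.ne'
    set γ := psgdStep D G s K
    set p := √((G ^ 2 + s ^ 2) * K)
    have e : √(D ^ 2 / K * (G ^ 2 + s ^ 2)) = D * p / K := by
      have : D ^ 2 / K * (G ^ 2 + s ^ 2) = (D * p / K) ^ 2 := by
        rw [div_pow, mul_pow, hsq]
        field_simp
      rw [this, Real.sqrt_sq (by positivity)]
    rw [e, one_div, inv_mul_le_iff₀ hK']
    have e₁ : (K : ℝ) * (2 * (D * p / K)) = 2 * (D * p) := by field_simp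
    have e₂ : (K : ℝ) * (2 * (G ^ 2 + s ^ 2) * γ ^ 2) = 2 * D ^ 2 := by
      rw [← hγp, mul_pow, hsq]
      ring
    rw [e₁]
    rw [e₂] at hmain
    refine le_of_mul_le_mul_left ?_ (by positivity : 0 < 2 * γ)
    have e₃ : 2 * γ * (2 * (D * p)) = 4 * D ^ 2 := by
      calc 2 * γ * (2 * (D * p)) = 4 * D * (γ * p) := by ring
        _ = _ := by rw [hγp]; ring
    nlinarith [sq_nonneg D]

end Rates

/-! ### From `K` and `s` to `qT`, `τ` and `σ`. -/

section Parameters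

variable {q τ σ : ℝ} {T : ℕ}

theorem one_le_of_numQueries_eq_zero (hq : 0 < q) (hT : 0 < T) (hτ : 0 ≤ τ)
    (hK : numQueries q τ T = 0) : 1 ≤ 2 * ((1 + τ) / (q * T)) := by
  have hT' : (0 : ℝ) < T := by exact_mod_cast hT
  rw [numQueries, Nat.floor_eq_zero, div_lt_one (by positivity)] at hK
  rw [← mul_div_assoc, le_div_iff₀ (by positivity)]
  linarith

/-- Rounding down a number that is at least one loses at most a factor of two. -/
theorem mul_le_two_mul_numQueries (hτ : 0 ≤ τ) (hK : 0 < numQueries q τ T) :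
    q * T ≤ 2 * numQueries q τ T * (1 + 2 * τ) := by
  have h₁ : q * T / (1 + 2 * τ) < numQueries q τ T + 1 := Nat.lt_floor_add_one _
  have h₂ : (1 : ℝ) ≤ numQueries q τ T := by exact_mod_cast hK
  rw [div_lt_iff₀ (by positivity)] at h₁
  nlinarith

theorem one_div_numQueries_le (hq : 0 < q) (hT : 0 < T) (hτ : 0 ≤ τ)
    (hK : 0 < numQueries q τ T) : 1 / (numQueries q τ T : ℝ) ≤ 4 * ((1 + τ) / (q * T)) := by
  have hT' : (0 : ℝ) < T := by exact_mod_cast hT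
  have hK' : (0 : ℝ) < numQueries q τ T := by exact_mod_cast hK
  have h := mul_le_two_mul_numQueries hτ hK
  rw [← mul_div_assoc, div_le_div_iff₀ hK' (by positivity)]
  nlinarith

theorem one_div_sqrt_numQueries_le (hq : 0 < q) (hT : 0 < T) (hτ : 0 ≤ τ)
    (hK : 0 < numQueries q τ T) :
    1 / √(numQueries q τ T : ℝ) ≤ 2 * (√(1 + τ) / √(q * T)) := by
  have h := Real.sqrt_le_sqrt (one_div_numQueries_le hq hT hτ hK)
  rw [Real.sqrt_div zero_le_one, Real.sqrt_one, Real.sqrt_mul (by norm_num),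
    Real.sqrt_div (by positivity), (by norm_num : (4 : ℝ) = 2 ^ 2),
    Real.sqrt_sq (by norm_num)] at h
  exact h

theorem batchStd_nonneg (hσ : 0 ≤ σ) : 0 ≤ batchStd σ τ := div_nonneg hσ (Real.sqrt_nonneg _)

theorem sq_le_batchSize_mul_batchStd_sq : σ ^ 2 ≤ batchSize τ * batchStd σ τ ^ 2 := by
  have h : (0 : ℝ) < max 1 τ := lt_max_of_lt_left one_pos
  rw [batchStd, div_pow, Real.sq_sqrt h.le, ← mul_div_assoc, le_div_iff₀ h, mul_comm]
  exact mul_le_mul_of_nonneg_right (le_batchSize τ) (sq_nonneg σ)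

/-- The delay cancels here: `K` is smaller than `qT` by a factor of order `max {1, τ}`, and `s²` is
smaller than `σ²` by exactly this maximum. -/
theorem batchStd_div_sqrt_numQueries_le (hq : 0 < q) (hT : 0 < T) (hτ : 0 ≤ τ) (hσ : 0 ≤ σ)
    (hK : 0 < numQueries q τ T) :
    batchStd σ τ / √(numQueries q τ T : ℝ) ≤ 3 * (σ / √(q * T)) := by
  have hT' : (0 : ℝ) < T := by exact_mod_cast hT
  have hK' : (0 : ℝ) < numQueries q τ T := by exact_mod_cast hK
  have hm : (0 : ℝ) < max 1 τ := lt_max_of_lt_left one_pos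
  have h := mul_le_two_mul_numQueries hτ hK
  -- `qT ≤ 2K(1 + 2τ) ≤ 6K max {1, τ}`; the `6` is rounded up to `3²`.
  have h₁ : √(q * T) ≤ 3 * (√(max 1 τ) * √(numQueries q τ T : ℝ)) := by
    rw [← Real.sqrt_mul hm.le, Real.sqrt_le_left (by positivity), mul_pow,
      Real.sq_sqrt (by positivity)]
    have h₂ : (1 : ℝ) + 2 * τ ≤ 3 * max 1 τ := by
      have := le_max_left 1 τ
      have := le_max_right 1 τ
      linarith
    have := mul_le_mul_of_nonneg_left h₂ (by positivity : (0 : ℝ) ≤ 2 * numQueries q τ T)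
    have : 0 < max 1 τ * numQueries q τ T := by positivity
    nlinarith
  rw [batchStd, div_div, ← mul_div_assoc, div_le_div_iff₀ (by positivity) (by positivity)]
  have := mul_le_mul_of_nonneg_left h₁ hσ
  linarith

theorem sqrt_sq_div_mul_sq {a s k : ℝ} (ha : 0 ≤ a) (hs : 0 ≤ s) (hk : 0 ≤ k) :
    √(a ^ 2 / k * s ^ 2) = a * (s / √k) := by
  have : a ^ 2 / k * s ^ 2 = (a * (s / √k)) ^ 2 := by
    rw [mul_pow, div_pow, Real.sq_sqrt hk]
    ring
  rw [this, Real.sqrt_sq (by positivity)]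

end Parameters

/-! ### The four settings. -/

section Cases

variable {E : Type*} [NormedAddCommGroup E] [InnerProductSpace ℝ E] [CompleteSpace E]
  [MeasurableSpace E] [BorelSpace E] [SecondCountableTopology E]
  {Ω Ξ : Type*} [MeasurableSpace Ω] [MeasurableSpace Ξ]
  {μ : Measure Ω} [IsProbabilityMeasure μ] {P : Measure Ξ} [IsProbabilityMeasure P]
  {ξ : ℕ → Ω → Ξ} {W : Set E} {f : E → ℝ} {f' : E → E} {g : E → Ξ → E} {w₁ : E}
  {T : ℕ} {d : ℕ → ℕ} {q τq τ σ : ℝ}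

theorem exists_batchGradient_output (E Ξ : Type*) [NormedAddCommGroup E] [InnerProductSpace ℝ E]
    (hT : 0 < T) (hq : 0 < q) (hd : IsQuantileDelay T d q τq) (hτ : τq ≤ τ) :
    ∃ S : ℕ → Finset ℕ, (∀ k < numQueries q τ T, (S k).card = batchSize τ) ∧
      Pairwise (Function.onFun Disjoint S) ∧
      ∀ (A : FirstOrderAlgorithm E) (g : E → Ξ → E) (z : ℕ → Ξ),
        asyncMiniBatch A (numQueries q τ T) (batchSize τ) T d g z =
          some (A.output (history (batchGradient A g S (batchSize τ)) (numQueries q τ T) z)) := by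
  obtain ⟨S, h₁, h₂, h₃⟩ := exists_schedule E Ξ (batchSize_pos τ) (numQueries_mul_le hT hq hd hτ)
  exact ⟨S, h₁, h₂, fun A g z => by rw [h₃, batchResponses_eq_history]⟩

/-- The `min` keeps the formula valid for every `r`, including values outside `{1, …, K}`, which the
random index takes on a null set. -/
theorem sgd_output_history (γ : ℝ) (w₁ : E) (r K : ℕ) (g : E → Ξ → E) (S : ℕ → Finset ℕ)
    (B : ℕ) (z : ℕ → Ξ) :
    (sgd γ w₁ r).output (history (batchGradient (sgd γ w₁ r) g S B) K z) =
      sgdIterate γ w₁ (history (batchGradient (sgd γ w₁ 0) g S B) (min (r - 1) K) z) := by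
  have : history (batchGradient (sgd γ w₁ r) g S B) K z =
      history (batchGradient (sgd γ w₁ 0) g S B) K z := by
    rw [← batchResponses_eq_history, ← batchResponses_eq_history, batchResponses_sgd]
  rw [this, ← take_history]
  rfl

theorem asyncMiniBatch_sgd_nonconvex (hf : ∀ x, HasGradientAt f (f' x) x) (hσ : 0 ≤ σ)
    (hg : IsGradientOracle Set.univ f' σ P g) (hξ : IsIIDSeeds μ P ξ) (hT : 0 < T) (hq : 0 < q)
    (hd : IsQuantileDelay T d q τq) (hτ : τq ≤ τ) {β F c : ℝ} {R : Ω → ℕ} (hβ0 : 0 < β)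
    (hβ : ∀ x y, ‖f' x - f' y‖ ≤ β * ‖x - y‖) (hc : ∀ x, c ≤ f x) (hF : f w₁ - c ≤ F)
    (hR : IsUniformIndex μ ξ (numQueries q τ T) R) :
    ∃ out : Ω → E,
      (∀ ω, asyncMiniBatch
        (sgd (sgdStepNonconvex β F (batchStd σ τ) (numQueries q τ T)) w₁ (R ω))
        (numQueries q τ T) (batchSize τ) T d g (fun t => ξ t ω) = some (out ω)) ∧
      Integrable (fun ω => ‖f' (out ω)‖ ^ 2) μ ∧
      ∫ ω, ‖f' (out ω)‖ ^ 2 ∂μ ≤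
        128 * ((1 + τ) * β * F / (q * T) + σ * √(β * F) / √(q * T)) := by
  have hτ0 : 0 ≤ τ := hd.nonneg.trans hτ
  have hT' : (0 : ℝ) < T := by exact_mod_cast hT
  have hF0 : 0 ≤ F := (sub_nonneg.2 (hc w₁)).trans hF
  obtain ⟨S, hcard, hdisj, hout⟩ := exists_batchGradient_output E Ξ hT hq hd hτ
  refine ⟨_, fun ω => hout _ g _, ?_⟩
  simp_rw [sgd_output_history]
  have e₁ : (1 + τ) * β * F / (q * T) = (1 + τ) / (q * T) * (β * F) := by ring
  have e₂ : σ * √(β * F) / √(q * T) = σ / √(q * T) * √(β * F) := by ring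
  rw [e₁, e₂]
  rcases Nat.eq_zero_or_pos (numQueries q τ T) with hK | hK
  · have h₀ := one_le_of_numQueries_eq_zero hq hT hτ0 hK
    simp only [hK, Nat.min_zero, history_zero, sgdIterate, List.foldl_nil]
    refine ⟨integrable_const _, ?_⟩
    have h₁ := norm_gradient_sq_le_of_lipschitz_gradient hf hβ0 hβ hc w₁
    have h₂ : 2 * β * (f w₁ - c) ≤ 2 * β * F := mul_le_mul_of_nonneg_left hF (by positivity)
    have h₃ := mul_le_mul_of_nonneg_right h₀ (by positivity : 0 ≤ β * F)
    have h₄ : 0 ≤ σ / √(q * T) * √(β * F) := by positivity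
    have h₅ : 0 ≤ β * F := by positivity
    simp only [integral_const, probReal_univ, one_smul]
    linarith
  · have hs := batchStd_nonneg (τ := τ) hσ
    have hresp := hg.isStochasticResponses
      (A := sgd (sgdStepNonconvex β F (batchStd σ τ) (numQueries q τ T)) w₁ 0)
      (fun l => Set.mem_univ _) (fun V k hV => measurable_sgdIterate_history _ w₁ k hV)
      (batchSize_pos τ) hcard hdisj sq_le_batchSize_mul_batchStd_sq
    have hrate := hresp.sgd_nonconvex_rate hf hβ0 hβ hc hF hK
    have hmix := hR.integral_eq hξ hK
      (h := fun k z => ‖f' (sgdIterate (sgdStepNonconvex β F (batchStd σ τ) (numQueries q τ T)) w₁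
        (history (batchGradient (sgd (sgdStepNonconvex β F (batchStd σ τ) (numQueries q τ T)) w₁ 0)
          g S (batchSize τ)) k z))‖ ^ 2)
      (fun k => ((continuous_of_norm_sub_le hβ).measurable.comp
        (measurable_sgdIterate_history _ w₁ k fun j _ => hresp.measurable j)).norm.pow_const 2)
      (fun k hk => (memLp_two_comp_of_lipschitz hβ
        (hresp.memLp_sgdIterate hβ hk.le)).integrable_norm_pow two_ne_zero)
    refine ⟨hmix.1, hmix.2.trans_le (hrate.trans ?_)⟩
    have h₁ := one_div_numQueries_le hq hT hτ0 hK
    have h₂ := batchStd_div_sqrt_numQueries_le hq hT hτ0 hσ hK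
    have e₃ : 2 * F / (numQueries q τ T : ℝ) * (β * batchStd σ τ ^ 2) =
        √(2 * (β * F)) ^ 2 / numQueries q τ T * batchStd σ τ ^ 2 := by
      rw [Real.sq_sqrt (by positivity)]
      ring
    rw [e₃, sqrt_sq_div_mul_sq (by positivity) hs (by positivity)]
    have h₃ : √(2 * (β * F)) ≤ 2 * √(β * F) := by
      rw [Real.sqrt_le_left (by positivity), mul_pow, Real.sq_sqrt (by positivity)]
      nlinarith [mul_nonneg hβ0.le hF0]
    have h₄ : √(2 * (β * F)) * (batchStd σ τ / √(numQueries q τ T : ℝ)) ≤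
        2 * √(β * F) * (3 * (σ / √(q * T))) := by gcongr
    have h₅ := mul_le_mul_of_nonneg_right h₁ (by positivity : 0 ≤ β * F)
    have h₆ : 0 ≤ σ / √(q * T) * √(β * F) := by positivity
    have h₇ : 0 ≤ (1 + τ) / (q * T) * (β * F) := by positivity
    have e₄ : 2 * F / (numQueries q τ T : ℝ) * β = 2 * (1 / (numQueries q τ T : ℝ) * (β * F)) := by
      ring
    rw [e₄]
    linarith

theorem asyncMiniBatch_sgd_convex (hf : ∀ x, HasGradientAt f (f' x) x) (hσ : 0 ≤ σ)
    (hg : IsGradientOracle Set.univ f' σ P g) (hξ : IsIIDSeeds μ P ξ) (hT : 0 < T) (hq : 0 < q)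
    (hd : IsQuantileDelay T d q τq) (hτ : τq ≤ τ) {β D : ℝ} {m : E} {R : Ω → ℕ} (hβ0 : 0 < β)
    (hβ : ∀ x y, ‖f' x - f' y‖ ≤ β * ‖x - y‖) (hconv : ConvexOn ℝ Set.univ f)
    (hm : ∀ x, f m ≤ f x) (hD : ‖w₁ - m‖ ≤ D)
    (hR : IsUniformIndex μ ξ (numQueries q τ T) R) :
    ∃ out : Ω → E,
      (∀ ω, asyncMiniBatch
        (sgd (sgdStepConvex β D (batchStd σ τ) (numQueries q τ T)) w₁ (R ω))
        (numQueries q τ T) (batchSize τ) T d g (fun t => ξ t ω) = some (out ω)) ∧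
      Integrable (fun ω => f (out ω) - f m) μ ∧
      ∫ ω, (f (out ω) - f m) ∂μ ≤
        128 * ((1 + τ) * β * D ^ 2 / (q * T) + D * σ / √(q * T)) := by
  have hτ0 : 0 ≤ τ := hd.nonneg.trans hτ
  have hT' : (0 : ℝ) < T := by exact_mod_cast hT
  have hD0 : 0 ≤ D := (norm_nonneg _).trans hD
  have hcont : Continuous f := continuous_iff_continuousAt.2 fun x => (hf x).continuousAt
  obtain ⟨S, hcard, hdisj, hout⟩ := exists_batchGradient_output E Ξ hT hq hd hτ
  refine ⟨_, fun ω => hout _ g _, ?_⟩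
  simp_rw [sgd_output_history]
  have e₁ : (1 + τ) * β * D ^ 2 / (q * T) = (1 + τ) / (q * T) * (β * D ^ 2) := by ring
  have e₂ : D * σ / √(q * T) = D * (σ / √(q * T)) := by ring
  rw [e₁, e₂]
  rcases Nat.eq_zero_or_pos (numQueries q τ T) with hK | hK
  · have h₀ := one_le_of_numQueries_eq_zero hq hT hτ0 hK
    simp only [hK, Nat.min_zero, history_zero, sgdIterate, List.foldl_nil]
    refine ⟨integrable_const _, ?_⟩
    have h₁ := le_quadratic_of_forall_le hf hβ hm w₁
    have h₂ : β / 2 * ‖w₁ - m‖ ^ 2 ≤ β / 2 * D ^ 2 := by gcongr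
    have h₃ := mul_le_mul_of_nonneg_right h₀ (by positivity : 0 ≤ β * D ^ 2)
    have h₄ : 0 ≤ D * (σ / √(q * T)) := by positivity
    have h₅ : 0 ≤ β * D ^ 2 := by positivity
    simp only [integral_const, probReal_univ, one_smul]
    linarith
  · have hs := batchStd_nonneg (τ := τ) hσ
    have hresp := hg.isStochasticResponses
      (A := sgd (sgdStepConvex β D (batchStd σ τ) (numQueries q τ T)) w₁ 0)
      (fun l => Set.mem_univ _) (fun V k hV => measurable_sgdIterate_history _ w₁ k hV)
      (batchSize_pos τ) hcard hdisj sq_le_batchSize_mul_batchStd_sq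
    have hrate := hresp.sgd_convex_rate hf hβ0 hβ hconv hm hD hK
    have hmix := hR.integral_eq hξ hK
      (h := fun k z => f (sgdIterate (sgdStepConvex β D (batchStd σ τ) (numQueries q τ T)) w₁
        (history (batchGradient (sgd (sgdStepConvex β D (batchStd σ τ) (numQueries q τ T)) w₁ 0)
          g S (batchSize τ)) k z)) - f m)
      (fun k => (hcont.measurable.comp
        (measurable_sgdIterate_history _ w₁ k fun j _ => hresp.measurable j)).sub_const _)
      (fun k hk => (integrable_comp_of_lipschitz_gradient hf hβ hm
        (hresp.memLp_sgdIterate hβ hk.le)).sub (integrable_const _))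
    refine ⟨hmix.1, hmix.2.trans_le (hrate.trans ?_)⟩
    have h₁ := one_div_numQueries_le hq hT hτ0 hK
    have h₂ := batchStd_div_sqrt_numQueries_le hq hT hτ0 hσ hK
    rw [sqrt_sq_div_mul_sq hD0 hs (by positivity)]
    have h₄ := mul_le_mul_of_nonneg_left h₂ hD0
    have h₅ := mul_le_mul_of_nonneg_right h₁ (by positivity : 0 ≤ β * D ^ 2)
    have h₆ : 0 ≤ D * (σ / √(q * T)) := by positivity
    have h₇ : 0 ≤ (1 + τ) / (q * T) * (β * D ^ 2) := by positivity
    have e₄ : D ^ 2 / (numQueries q τ T : ℝ) * β = 1 / (numQueries q τ T : ℝ) * (β * D ^ 2) := by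
      ring
    rw [e₄]
    linarith

theorem IsIIDSeeds.integrable_and_integral_le (hξ : IsIIDSeeds μ P ξ) {h : (ℕ → Ξ) → ℝ} {b : ℝ}
    (hi : Integrable h (Measure.infinitePi fun _ : ℕ => P))
    (hb : ∫ z, h z ∂(Measure.infinitePi fun _ : ℕ => P) ≤ b) :
    Integrable (fun ω => h fun t => ξ t ω) μ ∧ ∫ ω, h (fun t => ξ t ω) ∂μ ≤ b := by
  have hmp := hξ.measurePreserving
  refine ⟨hmp.integrable_comp_of_integrable hi, ?_⟩
  rw [← hmp.map_eq] at hi hb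
  rwa [integral_map hmp.measurable.aemeasurable hi.1] at hb

theorem asyncMiniBatch_acsa (hf : ∀ x, HasGradientAt f (f' x) x) (hσ : 0 ≤ σ)
    (hg : IsGradientOracle Set.univ f' σ P g) (hξ : IsIIDSeeds μ P ξ) (hT : 0 < T) (hq : 0 < q)
    (hd : IsQuantileDelay T d q τq) (hτ : τq ≤ τ) {β D : ℝ} {m : E} (hβ0 : 0 < β)
    (hβ : ∀ x y, ‖f' x - f' y‖ ≤ β * ‖x - y‖) (hconv : ConvexOn ℝ Set.univ f)
    (hm : ∀ x, f m ≤ f x) (hD : ‖w₁ - m‖ ≤ D) :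
    ∃ out : Ω → E,
      (∀ ω, asyncMiniBatch (acsa (acsaStep β D (batchStd σ τ) (numQueries q τ T)) w₁)
        (numQueries q τ T) (batchSize τ) T d g (fun t => ξ t ω) = some (out ω)) ∧
      Integrable (fun ω => f (out ω) - f m) μ ∧
      ∫ ω, (f (out ω) - f m) ∂μ ≤
        128 * ((1 + τ) ^ 2 * β * D ^ 2 / (q * T) ^ 2 + D * σ / √(q * T)) := by
  have hτ0 : 0 ≤ τ := hd.nonneg.trans hτ
  have hT' : (0 : ℝ) < T := by exact_mod_cast hT
  have hD0 : 0 ≤ D := (norm_nonneg _).trans hD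
  obtain ⟨S, hcard, hdisj, hout⟩ := exists_batchGradient_output E Ξ hT hq hd hτ
  refine ⟨_, fun ω => hout _ g _, ?_⟩
  have e₁ : (1 + τ) ^ 2 * β * D ^ 2 / (q * T) ^ 2 = ((1 + τ) / (q * T)) ^ 2 * (β * D ^ 2) := by
    ring
  have e₂ : D * σ / √(q * T) = D * (σ / √(q * T)) := by ring
  rw [e₁, e₂]
  rcases Nat.eq_zero_or_pos (numQueries q τ T) with hK | hK
  · have h₀ := one_le_of_numQueries_eq_zero hq hT hτ0 hK
    simp only [hK, history_zero, acsa, acsaIterate, List.foldl_nil]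
    refine ⟨integrable_const _, ?_⟩
    have h₁ := le_quadratic_of_forall_le hf hβ hm w₁
    have h₂ : β / 2 * ‖w₁ - m‖ ^ 2 ≤ β / 2 * D ^ 2 := by gcongr
    have h₃ : 1 ≤ 4 * ((1 + τ) / (q * T)) ^ 2 := by nlinarith
    have h₄ : 0 ≤ D * (σ / √(q * T)) := by positivity
    have h₅ : 0 ≤ β * D ^ 2 := by positivity
    have h₆ := mul_le_mul_of_nonneg_right h₃ h₅
    simp only [integral_const, probReal_univ, one_smul]
    linarith
  · have hs := batchStd_nonneg (τ := τ) hσ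
    have hresp := hg.isStochasticResponses
      (A := acsa (acsaStep β D (batchStd σ τ) (numQueries q τ T)) w₁)
      (fun l => Set.mem_univ _) (fun V k hV => measurable_acsa_query _ w₁ k hV)
      (batchSize_pos τ) hcard hdisj sq_le_batchSize_mul_batchStd_sq
    have hrate := hresp.acsa_rate hf hβ0 hβ hconv hm hD hK
    have hint := (integrable_comp_of_lipschitz_gradient hf hβ hm
      (hresp.memLp_acsa hβ le_rfl).2).sub (integrable_const (f m))
    refine hξ.integrable_and_integral_le (h := fun z => f (acsaAverage
      (acsaStep β D (batchStd σ τ) (numQueries q τ T)) w₁ (batchGradient (acsa (acsaStep β D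
        (batchStd σ τ) (numQueries q τ T)) w₁) g S (batchSize τ)) (numQueries q τ T) z) - f m)
      hint (hrate.trans ?_)
    have hK1 : (1 : ℝ) ≤ numQueries q τ T := by exact_mod_cast hK
    have h₁ := one_div_numQueries_le hq hT hτ0 hK
    have h₂ := batchStd_div_sqrt_numQueries_le hq hT hτ0 hσ hK
    have h₃ : D ^ 2 / (((numQueries q τ T : ℝ) + 1) * numQueries q τ T) *
        (4 / 3 * batchStd σ τ ^ 2 * (numQueries q τ T + 1)) ≤
        (2 * D) ^ 2 / numQueries q τ T * batchStd σ τ ^ 2 := by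
      have e : D ^ 2 / (((numQueries q τ T : ℝ) + 1) * numQueries q τ T) *
          (4 / 3 * batchStd σ τ ^ 2 * (numQueries q τ T + 1)) =
          4 / 3 * (D ^ 2 / numQueries q τ T * batchStd σ τ ^ 2) := by
        field_simp
      have h : 0 ≤ D ^ 2 / (numQueries q τ T : ℝ) * batchStd σ τ ^ 2 := by positivity
      have e' : (2 * D) ^ 2 / numQueries q τ T * batchStd σ τ ^ 2 =
          4 * (D ^ 2 / numQueries q τ T * batchStd σ τ ^ 2) := by ring
      rw [e, e']
      linarith
    have h₄ := (Real.sqrt_le_sqrt h₃).trans_eq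
      (sqrt_sq_div_mul_sq (by positivity) hs (by positivity))
    have h₅ := mul_le_mul_of_nonneg_left h₂ hD0
    have h₆ : D ^ 2 / (((numQueries q τ T : ℝ) + 1) * numQueries q τ T) * (4 * β) ≤
        4 * ((4 * ((1 + τ) / (q * T))) ^ 2 * (β * D ^ 2)) := by
      have h : D ^ 2 / (((numQueries q τ T : ℝ) + 1) * numQueries q τ T) ≤
          D ^ 2 / ((numQueries q τ T : ℝ) * numQueries q τ T) := by
        gcongr
        linarith
      have e : D ^ 2 / ((numQueries q τ T : ℝ) * numQueries q τ T) * (4 * β) =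
          4 * ((1 / (numQueries q τ T : ℝ)) ^ 2 * (β * D ^ 2)) := by
        field_simp
      refine (mul_le_mul_of_nonneg_right h (by positivity)).trans (e.trans_le ?_)
      gcongr
    have h₇ : 0 ≤ D * (σ / √(q * T)) := by positivity
    have h₈ : 0 ≤ ((1 + τ) / (q * T)) ^ 2 * (β * D ^ 2) := by positivity
    linarith

theorem psgd_output_history {α : Type*} (W : Set E) (γ : ℝ) (w₁ : E) (V : ℕ → α → E) {K : ℕ}
    (hK : 0 < K) (z : α) : (psgd W γ w₁).output (history V K z) =
      ∑ i ∈ Finset.range K, (1 / (K : ℝ)) • psgdIterate W γ w₁ (history V i z) := by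
  simp only [psgd, length_history, hK.ne', if_false]
  rw [Finset.smul_sum]
  refine Finset.sum_congr rfl fun i hi => ?_
  rw [take_history, min_eq_left (Finset.mem_range.1 hi).le]

theorem asyncMiniBatch_psgd (hf : ∀ w ∈ W, HasGradientWithinAt f (f' w) W w) (hσ : 0 ≤ σ)
    (hg : IsGradientOracle W f' σ P g) (hξ : IsIIDSeeds μ P ξ) (hw₁ : w₁ ∈ W) (hT : 0 < T)
    (hq : 0 < q) (hd : IsQuantileDelay T d q τq) (hτ : τq ≤ τ) {D G : ℝ} (hW : IsClosed W)
    (hD0 : 0 < D) (hD : ∀ x ∈ W, ∀ y ∈ W, ‖x - y‖ ≤ D) (hG0 : 0 ≤ G)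
    (hG : ∀ x ∈ W, ∀ y ∈ W, |f x - f y| ≤ G * ‖x - y‖) (hconv : ConvexOn ℝ W f) {m : E}
    (hm : m ∈ W) :
    ∃ out : Ω → E,
      (∀ ω, asyncMiniBatch (psgd W (psgdStep D G (batchStd σ τ) (numQueries q τ T)) w₁)
        (numQueries q τ T) (batchSize τ) T d g (fun t => ξ t ω) = some (out ω)) ∧
      (∀ ω, out ω ∈ W) ∧
      Integrable (fun ω => f (out ω) - f m) μ ∧
      ∫ ω, (f (out ω) - f m) ∂μ ≤ 128 * (D * (√(1 + τ) * G + σ) / √(q * T)) := by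
  have hτ0 : 0 ≤ τ := hd.nonneg.trans hτ
  have hT' : (0 : ℝ) < T := by exact_mod_cast hT
  obtain ⟨S, hcard, hdisj, hout⟩ := exists_batchGradient_output E Ξ hT hq hd hτ
  refine ⟨_, fun ω => hout _ g _, ?_⟩
  have e₁ : D * (√(1 + τ) * G + σ) / √(q * T) =
      D * (√(1 + τ) / √(q * T) * G) + D * (σ / √(q * T)) := by ring
  have h₁ : 0 ≤ D * (σ / √(q * T)) := by positivity
  have h₂ : 0 ≤ D * (√(1 + τ) / √(q * T) * G) := by positivity
  rw [e₁]
  rcases Nat.eq_zero_or_pos (numQueries q τ T) with hK | hK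
  · have h₀ := one_le_of_numQueries_eq_zero hq hT hτ0 hK
    simp only [hK, history_zero, psgd, List.length_nil, if_true]
    refine ⟨fun _ => hw₁, integrable_const _, ?_⟩
    have h₃ := (le_abs_self _).trans (hG _ hw₁ _ hm)
    have h₄ := mul_le_mul_of_nonneg_left (hD _ hw₁ _ hm) hG0
    have h₅ : 1 ≤ 2 * (√(1 + τ) / √(q * T)) := by
      have := Real.sqrt_le_sqrt h₀
      rw [Real.sqrt_one, Real.sqrt_mul (by norm_num), Real.sqrt_div (by positivity)] at this
      refine this.trans (mul_le_mul_of_nonneg_right ?_ (by positivity))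
      rw [Real.sqrt_le_left (by norm_num)]
      norm_num
    have h₆ := mul_le_mul_of_nonneg_right h₅ (by positivity : 0 ≤ D * G)
    simp only [integral_const, probReal_univ, one_smul]
    linarith
  · have hs := batchStd_nonneg (τ := τ) hσ
    have hresp := hg.isStochasticResponses
      (A := psgd W (psgdStep D G (batchStd σ τ) (numQueries q τ T)) w₁)
      (fun l => psgdIterate_mem hW hconv.1 _ hw₁ l)
      (fun V k hV => measurable_psgdIterate_history hW hconv.1 _ hw₁ k hV)
      (batchSize_pos τ) hcard hdisj sq_le_batchSize_mul_batchStd_sq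
    have hrate := hresp.psgd_rate hf hW hconv hD0 hD hG0 hG hw₁ hm hK
    have hK' : (0 : ℝ) < numQueries q τ T := by exact_mod_cast hK
    set γ := psgdStep D G (batchStd σ τ) (numQueries q τ T)
    set V := batchGradient (psgd W γ w₁) g S (batchSize τ)
    set K := numQueries q τ T
    simp_rw [psgd_output_history W γ w₁ V hK]
    have hXW : ∀ k z, psgdIterate W γ w₁ (history V k z) ∈ W := fun k z =>
      psgdIterate_mem hW hconv.1 γ hw₁ _
    have hXm : ∀ k, Measurable fun z => psgdIterate W γ w₁ (history V k z) := fun k =>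
      measurable_psgdIterate_history hW hconv.1 γ hw₁ k fun j _ => hresp.measurable j
    have hsum1 : ∑ _i ∈ Finset.range K, 1 / (K : ℝ) = 1 := by
      rw [Finset.sum_const, Finset.card_range, nsmul_eq_mul, mul_one_div_cancel hK'.ne']
    have hYW : ∀ z, ∑ i ∈ Finset.range K, (1 / (K : ℝ)) • psgdIterate W γ w₁ (history V i z) ∈ W :=
      fun z => hconv.1.sum_mem (fun i _ => by positivity) hsum1 fun i _ => hXW i z
    have hfi : ∀ k, Integrable (fun z => f (psgdIterate W γ w₁ (history V k z)) - f m)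
        (Measure.infinitePi fun _ : ℕ => P) := fun k =>
      integrable_comp_sub_of_lipschitzOn (continuousOn_of_hasGradientWithinAt hf) hD hG0 hG hm
        (hXm k) (hXW k)
    have hYi := integrable_comp_sub_of_lipschitzOn (ν := Measure.infinitePi fun _ : ℕ => P)
      (continuousOn_of_hasGradientWithinAt hf) hD hG0 hG hm
      (Finset.measurable_sum _ fun i _ => (hXm i).const_smul (1 / (K : ℝ))) hYW
    have hjensen : ∀ z,
        f (∑ i ∈ Finset.range K, (1 / (K : ℝ)) • psgdIterate W γ w₁ (history V i z)) - f m ≤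
        1 / (K : ℝ) * ∑ i ∈ Finset.range K, (f (psgdIterate W γ w₁ (history V i z)) - f m) := by
      intro z
      have h := hconv.map_sum_le (t := Finset.range K) (w := fun _ => 1 / (K : ℝ))
        (fun i _ => by positivity) hsum1 fun i _ => hXW i z
      simp only [smul_eq_mul, ← Finset.mul_sum] at h
      rw [Finset.sum_sub_distrib, Finset.sum_const, Finset.card_range, nsmul_eq_mul, mul_sub,
        ← mul_assoc, one_div_mul_cancel hK'.ne', one_mul]
      linarith
    have hmono := integral_mono hYi
      ((integrable_finsetSum (Finset.range K) fun i _ => hfi i).const_mul (1 / (K : ℝ))) hjensen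
    rw [integral_const_mul, integral_finsetSum _ fun i _ => hfi i] at hmono
    refine ⟨fun ω => hYW _, hξ.integrable_and_integral_le hYi (hmono.trans (hrate.trans ?_))⟩
    have h₃ := batchStd_div_sqrt_numQueries_le hq hT hτ0 hσ hK
    have h₄ := one_div_sqrt_numQueries_le hq hT hτ0 hK
    have h₅ : √(D ^ 2 / K * (G ^ 2 + batchStd σ τ ^ 2)) ≤ D * ((G + batchStd σ τ) / √(K : ℝ)) := by
      rw [← sqrt_sq_div_mul_sq hD0.le (by positivity) hK'.le]
      refine Real.sqrt_le_sqrt (mul_le_mul_of_nonneg_left ?_ (by positivity))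
      nlinarith [mul_nonneg hG0 hs]
    have e₂ : (G + batchStd σ τ) / √(K : ℝ) = 1 / √(K : ℝ) * G + batchStd σ τ / √(K : ℝ) := by
      ring
    rw [e₂] at h₅
    have h₆ := mul_le_mul_of_nonneg_left (add_le_add (mul_le_mul_of_nonneg_right h₄ hG0) h₃) hD0.le
    linarith

end Cases

/-! ### Assembly. -/

theorem mainTheorem2 :
    ∃ C : ℝ, 0 < C ∧
    ∀ (n : ℕ) (Ω Ξ : Type*) [MeasurableSpace Ω] [MeasurableSpace Ξ]
      (μ : Measure Ω) [IsProbabilityMeasure μ] (P : Measure Ξ) (ξ : ℕ → Ω → Ξ)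
      (W : Set (EuclideanSpace ℝ (Fin n)))
      (f : EuclideanSpace ℝ (Fin n) → ℝ)
      (f' : EuclideanSpace ℝ (Fin n) → EuclideanSpace ℝ (Fin n))
      (g : EuclideanSpace ℝ (Fin n) → Ξ → EuclideanSpace ℝ (Fin n))
      (w₁ : EuclideanSpace ℝ (Fin n))
      (T : ℕ) (d : ℕ → ℕ) (q τq τ σ : ℝ),
      -- the differentiable objective, its stochastic gradients and the initial point
      (∀ w ∈ W, HasGradientWithinAt f (f' w) W w) →
      0 ≤ σ → IsGradientOracle W f' σ P g → IsIIDSeeds μ P ξ → w₁ ∈ W →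
      -- the rounds, their delays and the bound on the quantile delay
      0 < T → IsDelaySequence T d → 0 < q → q ≤ 1 → IsQuantileDelay T d q τq → τq ≤ τ →
      -- non-convex smooth setting, SGD
      (∀ (β F fstar : ℝ) (R : Ω → ℕ), W = Set.univ → 0 < β →
        (∀ x y, ‖f' x - f' y‖ ≤ β * ‖x - y‖) → (∀ x, fstar ≤ f x) → f w₁ - fstar ≤ F →
        IsUniformIndex μ ξ (numQueries q τ T) R →
        ∃ out : Ω → EuclideanSpace ℝ (Fin n),
          (∀ ω, asyncMiniBatch
            (sgd (sgdStepNonconvex β F (batchStd σ τ) (numQueries q τ T)) w₁ (R ω))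
            (numQueries q τ T) (batchSize τ) T d g (fun t => ξ t ω) = some (out ω)) ∧
          Integrable (fun ω => ‖f' (out ω)‖ ^ 2) μ ∧
          ∫ ω, ‖f' (out ω)‖ ^ 2 ∂μ ≤
            C * ((1 + τ) * β * F / (q * T) + σ * √(β * F) / √(q * T))) ∧
      -- convex smooth setting, SGD
      (∀ (β D : ℝ) (wstar : EuclideanSpace ℝ (Fin n)) (R : Ω → ℕ), W = Set.univ → 0 < β →
        (∀ x y, ‖f' x - f' y‖ ≤ β * ‖x - y‖) → ConvexOn ℝ Set.univ f → (∀ x, f wstar ≤ f x) →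
        ‖w₁ - wstar‖ ≤ D →
        IsUniformIndex μ ξ (numQueries q τ T) R →
        ∃ out : Ω → EuclideanSpace ℝ (Fin n),
          (∀ ω, asyncMiniBatch
            (sgd (sgdStepConvex β D (batchStd σ τ) (numQueries q τ T)) w₁ (R ω))
            (numQueries q τ T) (batchSize τ) T d g (fun t => ξ t ω) = some (out ω)) ∧
          Integrable (fun ω => f (out ω) - f wstar) μ ∧
          ∫ ω, (f (out ω) - f wstar) ∂μ ≤
            C * ((1 + τ) * β * D ^ 2 / (q * T) + D * σ / √(q * T))) ∧
      -- convex smooth setting, accelerated SGD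
      (∀ (β D : ℝ) (wstar : EuclideanSpace ℝ (Fin n)), W = Set.univ → 0 < β →
        (∀ x y, ‖f' x - f' y‖ ≤ β * ‖x - y‖) → ConvexOn ℝ Set.univ f → (∀ x, f wstar ≤ f x) →
        ‖w₁ - wstar‖ ≤ D →
        ∃ out : Ω → EuclideanSpace ℝ (Fin n),
          (∀ ω, asyncMiniBatch
            (acsa (acsaStep β D (batchStd σ τ) (numQueries q τ T)) w₁)
            (numQueries q τ T) (batchSize τ) T d g (fun t => ξ t ω) = some (out ω)) ∧
          Integrable (fun ω => f (out ω) - f wstar) μ ∧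
          ∫ ω, (f (out ω) - f wstar) ∂μ ≤
            C * ((1 + τ) ^ 2 * β * D ^ 2 / (q * T) ^ 2 + D * σ / √(q * T))) ∧
      -- convex Lipschitz setting, projected SGD
      (∀ (D G : ℝ), IsClosed W → Convex ℝ W → 0 < D → (∀ x ∈ W, ∀ y ∈ W, ‖x - y‖ ≤ D) →
        0 ≤ G → (∀ x ∈ W, ∀ y ∈ W, |f x - f y| ≤ G * ‖x - y‖) → ConvexOn ℝ W f →
        ∃ wstar ∈ W, (∀ x ∈ W, f wstar ≤ f x) ∧
        ∃ out : Ω → EuclideanSpace ℝ (Fin n),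
          (∀ ω, asyncMiniBatch
            (psgd W (psgdStep D G (batchStd σ τ) (numQueries q τ T)) w₁)
            (numQueries q τ T) (batchSize τ) T d g (fun t => ξ t ω) = some (out ω)) ∧
          (∀ ω, out ω ∈ W) ∧
          Integrable (fun ω => f (out ω) - f wstar) μ ∧
          ∫ ω, (f (out ω) - f wstar) ∂μ ≤
            C * (D * (√(1 + τ) * G + σ) / √(q * T))) := by
  -- The largest constant that occurs is `96 = 3/2 * 4 * 4²`, in the noise-free term of accelerated
  -- SGD.
  refine ⟨128, by norm_num, ?_⟩
  intro n Ω Ξ _ _ μ _ P ξ W f f' g w₁ T d q τq τ σ hf hσ hg hξ hw₁ hT _ hq _ hd hτ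
  have : IsProbabilityMeasure P :=
    hξ.law 0 ▸ Measure.isProbabilityMeasure_map (hξ.measurable 0).aemeasurable
  refine ⟨?_, ?_, ?_, ?_⟩
  · rintro β F c R rfl hβ0 hβ hc hF hR
    exact asyncMiniBatch_sgd_nonconvex (fun x => hasGradientWithinAt_univ.1 (hf x trivial)) hσ hg
      hξ hT hq hd hτ hβ0 hβ hc hF hR
  · rintro β D m R rfl hβ0 hβ hconv hm hD hR
    exact asyncMiniBatch_sgd_convex (fun x => hasGradientWithinAt_univ.1 (hf x trivial)) hσ hg
      hξ hT hq hd hτ hβ0 hβ hconv hm hD hR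
  · rintro β D m rfl hβ0 hβ hconv hm hD
    exact asyncMiniBatch_acsa (fun x => hasGradientWithinAt_univ.1 (hf x trivial)) hσ hg
      hξ hT hq hd hτ hβ0 hβ hconv hm hD
  · intro D G hW _ hD0 hD hG0 hG hconv
    have hbdd : Bornology.IsBounded W := Metric.isBounded_iff.2
      ⟨D, fun x hx y hy => by simpa [dist_eq_norm] using hD x hx y hy⟩
    obtain ⟨m, hm, hmin⟩ := (Metric.isCompact_of_isClosed_isBounded hW hbdd).exists_isMinOn
      ⟨w₁, hw₁⟩ (continuousOn_of_hasGradientWithinAt hf)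
    exact ⟨m, hm, fun x hx => hmin hx,
      asyncMiniBatch_psgd hf hσ hg hξ hw₁ hT hq hd hτ hW hD0 hD hG0 hG hconv hm⟩
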